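/- Consider $N$ double-integrator agents $\dot x_i=v_i$, $\dot v_i=b_iu_i$ ($i=1,\dots,N$) with unknown constants $b_i\neq0$ of possibly different signs. Let $\mathcal G_1,\dots,\mathcal G_M$ be weighted directed graphs on $\{1,\dots,N\}$ with nonnegative adjacency matrices $A_1,\dots,A_M$ (an edge $k\to i$ is present in $\mathcal G_\ell$ iff $(A_\ell)_{ik}>0$) and Laplacians $L_\ell=D_\ell-A_\ell$, where $D_\ell$ is the diagonal matrix of the row sums of $A_\ell$. A basis bicomponent of a directed graph is a (nonempty) strongly connected subgraph without incoming links from other nodes. Assume: (i) the graphs $\mathcal G_\ell$ have a jointly strongly connected basis: the union of all basis bicomponents of all $\mathcal G_\ell$ is a strongly connected graph having all of $\{1,\dots,N\}$ as vertices; (ii) there are switching times $0=t_1<t_2<\cdots$ with $t_{j+1}-t_j>\tau_{\min}$ for all $j$ and some $\tau_{\min}>0$, and a map $\bar n:\mathbb N_+\to\{1,\dots,M\}$, such that the adjacency matrix $(a_{ik}(t))$ in use at time $t$ is $A_{\bar n(j)}$ for $t\in[t_j,t_{j+1})$; (iii) for each $\ell$ there are a constant $\tau_{\max}>0$ and sequences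 $T^a_{\ell\nu},T^d_{\ell\nu}\in\{t_j\}$ ($\nu\ge1$) with $T^a_{\ell\nu}<T^d_{\ell\nu}\le T^a_{\ell,\nu+1}\le T^d_{\ell\nu}+\tau_{\max}$, such that the Laplacian of $(a_{ik}(t))$ is $L_\ell$ on $[T^a_{\ell\nu},T^d_{\ell\nu})$ for all $\nu$. Let $\rho,\lambda_1,\lambda_2>0$ and put $\zeta_i=\sum_k a_{ik}(v_i-v_k)$, $\eta_i=\sum_k a_{ik}(x_i-x_k)$, $q_i=v_i+\rho x_i$, $r_i=\zeta_i+\rho\eta_i$, $$R_i(t)=\tfrac12q_i^2(t)+\tfrac\rho2x_i^2(t)+\lambda_1\int_0^tq_i^2r_i^2\,ds+\int_0^tv_i^2\,ds+\tfrac{\lambda_2}2\Big[\int_0^tq_ir_i\,ds\Big]^2,$$ $$u_i(t)=R_i(t)\cos(R_i(t))\Big[(\rho+1)v_i(t)+r_i(t)\Big(\lambda_1q_i(t)r_i(t)+\lambda_2\int_0^tq_ir_i\,ds\Big)\Big].$$ A solution of the closed loop is a pair of continuous functions $(x,v)$ that satisfies the differential equations at all times other than the $t_j$. Then for every initial value $(x(0),v(0))$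 the closed loop has a solution on $[0,\infty)$, any two solutions on an interval $[0,T)$ with the same initial value coincide there, and for every solution on $[0,\infty)$: all $x_i,v_i,u_i$ are bounded on $[0,\infty)$; $x_i(t)-x_k(t)\to0$ and $v_i(t)-v_k(t)\to0$ as $t\to\infty$ for all $i,k$; and in fact $v_i(t)\to0$ for all $i$. -/

import Mathlib

open Filter Topology Set

namespace ConsensusPI

noncomputable section

/-- The directed graph with edge `k → i` exactly when the coupling strength `A i k` is positive. -/
def graphOf {N : ℕ} (A : Matrix (Fin N) (Fin N) ℝ) : Digraph (Fin N) where
  Adj k i := 0 < A i k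

/-- The Laplacian `D - A`, where `D` is the diagonal matrix of the in-degrees `∑ k, A i k`. -/
def laplacian {N : ℕ} (A : Matrix (Fin N) (Fin N) ℝ) : Matrix (Fin N) (Fin N) ℝ :=
  Matrix.diagonal (fun i => ∑ k, A i k) - A

/-- A directed graph is strongly connected if a directed path joins any node to any other. -/
def StronglyConnected {V : Type*} (G : Digraph V) : Prop :=
  ∀ i j : V, i ≠ j → Relation.TransGen G.Adj i j

/-- `S` is the vertex set of a basis bicomponent of `G`: the subgraph of `G` on `S` is nonempty
and strongly connected, and no link of `G` enters `S` from a node outside `S`.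
A single node without incoming links from other nodes is a basis bicomponent. -/
def IsBasisBicomponent {V : Type*} (G : Digraph V) (S : Set V) : Prop :=
  S.Nonempty ∧
  StronglyConnected (V := S) ⟨fun k i => G.Adj k i⟩ ∧
  ∀ k i : V, i ∈ S → G.Adj k i → k ∈ S

/-- The union of all basis bicomponents of all the graphs of a group (its edges). -/
def basisUnion {V ι : Type*} (G : ι → Digraph V) : Digraph V where
  Adj k i := ∃ (l : ι) (S : Set V),
    IsBasisBicomponent (G l) S ∧ k ∈ S ∧ i ∈ S ∧ (G l).Adj k i

/-- The union of all basis bicomponents of the graphs contains every node and is strongly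
connected. -/
def JointlyStronglyConnectedBasis {V ι : Type*} (G : ι → Digraph V) : Prop :=
  (∀ i : V, ∃ (l : ι) (S : Set V), IsBasisBicomponent (G l) S ∧ i ∈ S) ∧
  StronglyConnected (basisUnion G)

/-- The switching topologies: `A l` (`l : Fin M`) are the adjacency matrices of the available
topologies, `τ 0 = 0 < τ 1 < τ 2 < ⋯` the switching times, `n j` the index of the topology that is
used on `[τ j, τ (j+1))`, and `a t` the adjacency matrix at time `t ≥ 0`. -/
structure SwitchingTopology {N M : ℕ} (A : Fin M → Matrix (Fin N) (Fin N) ℝ)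
    (τ : ℕ → ℝ) (n : ℕ → Fin M) (a : ℝ → Matrix (Fin N) (Fin N) ℝ) : Prop where
  weights_nonneg : ∀ l i k, 0 ≤ A l i k
  start : τ 0 = 0
  dwell : ∃ τmin : ℝ, 0 < τmin ∧ ∀ j, τmin < τ (j + 1) - τ j
  active : ∀ j, ∀ t ∈ Ico (τ j) (τ (j + 1)), a t = A (n j)
  joint : JointlyStronglyConnectedBasis (fun l => graphOf (A l))
  /-- Every topology `l` is active on intervals `[Ta ν, Td ν)`, with gaps at most `τmax`
  between consecutive intervals. -/
  reactivation : ∀ l : Fin M, ∃ (Ta Td : ℕ → ℝ) (τmax : ℝ), 0 < τmax ∧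
    (∀ ν, Ta ν ∈ range τ ∧ Td ν ∈ range τ) ∧
    (∀ ν, Ta ν < Td ν ∧ Td ν ≤ Ta (ν + 1)) ∧
    (∀ ν, ∀ t ∈ Ico (Ta ν) (Td ν), laplacian (a t) = laplacian (A l)) ∧
    ∀ ν, Ta (ν + 1) - Td ν ≤ τmax

/-- The weighted disagreement `∑ k, a_{ik}(t) (y_i(t) - y_k(t))`: this is `ζ_i` for `y = v`
and `η_i` for `y = x`. -/
def disagreement {N : ℕ} (a : ℝ → Matrix (Fin N) (Fin N) ℝ) (y : Fin N → ℝ → ℝ)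
    (i : Fin N) (t : ℝ) : ℝ :=
  ∑ k, a t i k * (y i t - y k t)

/-- `q_i = v_i + ρ x_i`. -/
def q {N : ℕ} (ρ : ℝ) (x v : Fin N → ℝ → ℝ) (i : Fin N) (t : ℝ) : ℝ :=
  v i t + ρ * x i t

/-- `r_i = ζ_i + ρ η_i`. -/
def r {N : ℕ} (ρ : ℝ) (a : ℝ → Matrix (Fin N) (Fin N) ℝ) (x v : Fin N → ℝ → ℝ)
    (i : Fin N) (t : ℝ) : ℝ :=
  disagreement a v i t + ρ * disagreement a x i t

/-- The nonlinear PI function `R_i`. -/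
def R {N : ℕ} (ρ l₁ l₂ : ℝ) (a : ℝ → Matrix (Fin N) (Fin N) ℝ) (x v : Fin N → ℝ → ℝ)
    (i : Fin N) (t : ℝ) : ℝ :=
  1 / 2 * q ρ x v i t ^ 2 + ρ / 2 * x i t ^ 2
    + l₁ * (∫ s in (0 : ℝ)..t, q ρ x v i s ^ 2 * r ρ a x v i s ^ 2)
    + (∫ s in (0 : ℝ)..t, v i s ^ 2)
    + l₂ / 2 * (∫ s in (0 : ℝ)..t, q ρ x v i s * r ρ a x v i s) ^ 2

/-- The control input `u_i`. -/
def u {N : ℕ} (ρ l₁ l₂ : ℝ) (a : ℝ → Matrix (Fin N) (Fin N) ℝ) (x v : Fin N → ℝ → ℝ)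
    (i : Fin N) (t : ℝ) : ℝ :=
  R ρ l₁ l₂ a x v i t * Real.cos (R ρ l₁ l₂ a x v i t) *
    ((ρ + 1) * v i t + r ρ a x v i t *
      (l₁ * (q ρ x v i t * r ρ a x v i t)
        + l₂ * ∫ s in (0 : ℝ)..t, q ρ x v i s * r ρ a x v i s))

/-- `(x, v)` solves the closed-loop system `x_i' = v_i`, `v_i' = b_i u_i` on the time interval `J`
(of the form `[0, T)` or `[0, ∞)`): the states are continuous on `J`, and the differential
equations hold at all times of `J` other than the switching times `τ j`. -/
structure IsClosedLoopSolution {N : ℕ} (b : Fin N → ℝ) (ρ l₁ l₂ : ℝ) (τ : ℕ → ℝ)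
    (a : ℝ → Matrix (Fin N) (Fin N) ℝ) (J : Set ℝ) (x v : Fin N → ℝ → ℝ) : Prop where
  cont_x : ∀ i, ContinuousOn (x i) J
  cont_v : ∀ i, ContinuousOn (v i) J
  deriv_x : ∀ i, ∀ t ∈ J, t ∉ range τ → HasDerivAt (x i) (v i t) t
  deriv_v : ∀ i, ∀ t ∈ J, t ∉ range τ → HasDerivAt (v i) (b i * u ρ l₁ l₂ a x v i t) t

end

end ConsensusPI

/-!
Once the integrals in `Rᵢ` and `uᵢ` are made coordinates of the state, the closed loop is a smooth
autonomous system between switching times, and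
`Rᵢ' = qᵢ gᵢ (1 + bᵢ Rᵢ cos Rᵢ)`, where `gᵢ` is the last factor of `uᵢ`. Since `z cos z` takes
every value at arbitrarily large `z`, there are zeros of `1 + bᵢ z cos z` above `Rᵢ(0)`, whatever
the sign of `bᵢ`; these are equilibria of the equation for `Rᵢ`, which `Rᵢ` cannot cross. As `Rᵢ`
dominates all coordinates, the augmented state is bounded in terms of its initial value. The same
barriers work if the vector field is multiplied by a cutoff function, which gives global existence.

The integral of `λ₁ qᵢ² rᵢ² + vᵢ²` is therefore bounded, and the integrand is Lipschitz between
switching times, which are uniformly separated, so `qᵢ rᵢ → 0` and `vᵢ → 0` as in Barbalat's lemma.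
While `𝒢_ℓ` is active, `r = L_ℓ q`; on a basis bicomponent, `qᵢ (L_ℓ q)ᵢ = 0` for all `i` forces
the `qᵢ` to agree, by considering a node where `|qᵢ|` is maximal. By compactness the differences
`qᵢ - qₖ`, hence `xᵢ - xₖ`, are small whenever `𝒢_ℓ` is active late, and as `v → 0` they remain so
until the next activation. The basis bicomponents together connect all the agents.
-/

namespace ConsensusPI

/-! ### One-sided calculus -/

section Calculus

variable {f f' : ℝ → ℝ} {a b : ℝ}

theorem monotoneOn_of_deriv_right_nonneg (hf : ContinuousOn f (Icc a b))
    (hd : ∀ t ∈ Ico a b, HasDerivWithinAt f (f' t) (Ici t) t) (hf' : ∀ t ∈ Ico a b, 0 ≤ f' t) :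
    MonotoneOn f (Icc a b) := by
  intro s hs t ht hst
  exact image_le_of_deriv_right_le_deriv_boundary (f := fun _ => f s)
    continuousOn_const (fun r _ => hasDerivWithinAt_const r (Ici r) (f s)) le_rfl
    (hf.mono (Icc_subset_Icc hs.1 ht.2)) (fun r hr => hd r (Ico_subset_Ico hs.1 ht.2 hr))
    (fun r hr => hf' r (Ico_subset_Ico hs.1 ht.2 hr)) (right_mem_Icc.2 hst)

theorem mul_sub_le_image_sub_of_le_deriv_right {c : ℝ} (hab : a ≤ b) (hf : ContinuousOn f (Icc a b))
    (hd : ∀ t ∈ Ico a b, HasDerivWithinAt f (f' t) (Ici t) t) (hf' : ∀ t ∈ Ico a b, c ≤ f' t) :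
    c * (b - a) ≤ f b - f a := by
  have hmono : MonotoneOn (fun t => f t - c * t) (Icc a b) :=
    monotoneOn_of_deriv_right_nonneg (f' := fun t => f' t - c) (by fun_prop)
      (fun t ht => (hd t ht).sub (by simpa using (hasDerivWithinAt_id t (Ici t)).const_mul c))
      (fun t ht => sub_nonneg.2 (hf' t ht))
  linarith [hmono (left_mem_Icc.2 hab) (right_mem_Icc.2 hab) hab]

theorem lipschitzOnWith_Ici_of_norm_deriv_right_le {E : Type*} [NormedAddCommGroup E]
    [NormedSpace ℝ E] {y y' : ℝ → E} {C : NNReal} (hy : ContinuousOn y (Ici a))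
    (hd : ∀ t, a ≤ t → HasDerivWithinAt y (y' t) (Ici t) t) (hC : ∀ t, a ≤ t → ‖y' t‖ ≤ C) :
    LipschitzOnWith C y (Ici a) := by
  have hle : ∀ s ∈ Ici a, ∀ t, s ≤ t → dist (y t) (y s) ≤ C * dist t s := fun s hs t hst => by
    rw [dist_eq_norm, Real.dist_eq, abs_of_nonneg (sub_nonneg.2 hst)]
    exact norm_image_sub_le_of_norm_deriv_right_le_segment
      (hy.mono fun r hr => le_trans hs hr.1) (fun r hr => hd r (le_trans hs hr.1))
      (fun r hr => hC r (le_trans hs hr.1)) t (right_mem_Icc.2 hst)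
  refine LipschitzOnWith.of_dist_le_mul fun s hs t ht => ?_
  rcases le_total s t with hst | hst
  · rw [dist_comm (y s), dist_comm s]
    exact hle s hs t hst
  · exact hle t ht s hst

theorem continuousOn_Ici_of_forall_Ico {X : Type*} [TopologicalSpace X] {y : ℝ → X}
    (h : ∀ T, ContinuousOn y (Ico a T)) : ContinuousOn y (Ici a) := fun t ht => by
  have ht' : t < t + 1 := lt_add_one t
  refine (h (t + 1) t ⟨ht, ht'⟩).mono_of_mem_nhdsWithin ?_
  rw [← Ici_inter_Iio]
  exact inter_mem self_mem_nhdsWithin (mem_nhdsWithin_of_mem_nhds (Iio_mem_nhds ht'))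

theorem tendsto_sub_of_tendsto_deriv_zero (hf : ContinuousOn f (Ici a))
    (hd : ∀ t, a ≤ t → HasDerivWithinAt f (f' t) (Ici t) t) (hf' : Tendsto f' atTop (𝓝 0))
    {s : ℝ → ℝ} {D : ℝ} (hs : ∀ᶠ t in atTop, t ≤ s t ∧ s t ≤ t + D) :
    Tendsto (fun t => f (s t) - f t) atTop (𝓝 0) := by
  rw [Metric.tendsto_nhds]
  intro ε hε
  set δ := ε / (|D| + 1)
  have hδ : 0 < δ := by positivity
  obtain ⟨T, hT⟩ := eventually_atTop.1 (Metric.tendsto_nhds.1 hf' δ hδ)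
  filter_upwards [hs, eventually_ge_atTop (max a T)] with t hst ht
  have hbound : ‖f (s t) - f t‖ ≤ δ * (s t - t) :=
    norm_image_sub_le_of_norm_deriv_right_le_segment
      (hf.mono fun r hr => (le_max_left a T).trans (ht.trans hr.1))
      (fun r hr => hd r ((le_max_left a T).trans (ht.trans hr.1)))
      (fun r hr => by simpa using (hT r ((le_max_right a T).trans (ht.trans hr.1))).le)
      (s t) (right_mem_Icc.2 hst.1)
  calc dist (f (s t) - f t) 0 ≤ δ * (s t - t) := by simpa using hbound
    _ ≤ δ * |D| := by gcongr; linarith [le_abs_self D]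
    _ < δ * (|D| + 1) := by gcongr; linarith
    _ = ε := div_mul_cancel₀ _ (by positivity)

end Calculus

theorem tendsto_zero_of_mul_sq_le {α : Type*} {l : Filter α} {f g : α → ℝ} {c : ℝ} (hc : 0 < c)
    (hfg : ∀ t, c * g t ^ 2 ≤ f t) (hf : Tendsto f l (𝓝 0)) : Tendsto g l (𝓝 0) := by
  have hsq : Tendsto (fun t => g t ^ 2) l (𝓝 0) :=
    squeeze_zero (fun t => sq_nonneg (g t)) (fun t => (le_div_iff₀' hc).2 (hfg t))
      (by simpa using hf.div_const c)
  rw [tendsto_zero_iff_abs_tendsto_zero]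
  simpa [Function.comp_def, Real.sqrt_sq_eq_abs] using hsq.sqrt

/-! ### Barbalat's lemma -/

theorem tendsto_zero_of_bddAbove_primitive {f P : ℝ → ℝ} {a C : ℝ} (hP : ContinuousOn P (Ici a))
    (hd : ∀ t, a ≤ t → HasDerivWithinAt P (f t) (Ici t) t) (hf : ∀ t, a ≤ t → 0 ≤ f t)
    (hC : ∀ t, a ≤ t → P t ≤ C)
    (hslow : ∀ ε > 0, ∃ δ > 0, ∀ t ≥ a, ∃ s ∈ Icc (t - δ) t, ∀ r ∈ Ico s (s + δ), f t - ε ≤ f r) :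
    Tendsto f atTop (𝓝 0) := by
  have hmono : MonotoneOn P (Ici a) := fun s hs t ht hst =>
    monotoneOn_of_deriv_right_nonneg (hP.mono Icc_subset_Ici_self) (fun r hr => hd r hr.1)
      (fun r hr => hf r hr.1) ⟨hs, hst⟩ (right_mem_Icc.2 ht) hst
  have hbdd : BddAbove (P '' Ici a) := ⟨C, forall_mem_image.2 hC⟩
  rw [Metric.tendsto_atTop]
  intro ε hε
  obtain ⟨δ, hδ, hδf⟩ := hslow (ε / 2) (by positivity)
  obtain ⟨_, ⟨t₀, ht₀, rfl⟩, hPt₀⟩ := exists_lt_of_lt_csSup (nonempty_Ici.image P)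
    (sub_lt_self (sSup (P '' Ici a)) (by positivity : 0 < ε / 2 * δ))
  rw [mem_Ici] at ht₀
  refine ⟨t₀ + δ, fun t ht => ?_⟩
  have hat : a ≤ t := by linarith
  rw [Real.dist_eq, sub_zero, abs_of_nonneg (hf t hat)]
  by_contra! hεt
  obtain ⟨s, hs, hsf⟩ := hδf t hat
  have ht₀s : t₀ ≤ s := by linarith [hs.1]
  have has : a ≤ s := ht₀.trans ht₀s
  have hgrow : ε / 2 * (s + δ - s) ≤ P (s + δ) - P s :=
    mul_sub_le_image_sub_of_le_deriv_right (by linarith)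
      (hP.mono fun r hr => has.trans hr.1) (fun r hr => hd r (has.trans hr.1))
      (fun r hr => by linarith [hsf r hr])
  have hPs : P t₀ ≤ P s := hmono ht₀ has ht₀s
  have hsup : P (s + δ) ≤ sSup (P '' Ici a) :=
    le_csSup hbdd (mem_image_of_mem P (mem_Ici.2 (by linarith)))
  linarith

/-! ### Sequences of times -/

section DwellTime

variable {τ : ℕ → ℝ} {d : ℝ}

theorem tendsto_atTop_of_dwell (hd : 0 < d) (hτ : ∀ j, d ≤ τ (j + 1) - τ j) :
    Tendsto τ atTop atTop := by
  have hlin : ∀ j : ℕ, τ 0 + j * d ≤ τ j := fun j => by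
    induction j with
    | zero => simp
    | succ j ih => push_cast; linarith [hτ j]
  exact tendsto_atTop_mono hlin
    (tendsto_atTop_add_const_left _ _ (tendsto_natCast_atTop_atTop.atTop_mul_const hd))

theorem exists_mem_Ico_of_dwell (hd : 0 < d) (hτ : ∀ j, d ≤ τ (j + 1) - τ j) {t : ℝ}
    (ht : τ 0 ≤ t) : ∃ j, t ∈ Ico (τ j) (τ (j + 1)) := by
  have hmono : Monotone τ := monotone_nat_of_le_succ fun j => by linarith [hτ j]
  have hcover := iUnion_Ico_map_succ_eq_Ici (fun j => hmono bot_le)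
    (not_bddAbove_of_tendsto_atTop (tendsto_atTop_of_dwell hd hτ))
  exact mem_iUnion.1 (hcover.ge ht)

theorem exists_window_of_lipschitzOnWith_Ico (hd : 0 < d) (hτ : ∀ j, d ≤ τ (j + 1) - τ j)
    {f : ℝ → ℝ} {K : NNReal} (hf : ∀ j, LipschitzOnWith K f (Ico (τ j) (τ (j + 1)))) {ε : ℝ}
    (hε : 0 < ε) :
    ∃ δ > 0, ∀ t ≥ τ 0, ∃ s ∈ Icc (t - δ) t, ∀ r ∈ Ico s (s + δ), f t - ε ≤ f r := by
  set δ := min (d / 2) (ε / (K + 1))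
  have hKδ : K * δ ≤ ε := by
    have : δ * (K + 1) ≤ ε := (le_div_iff₀ (by positivity)).1 (min_le_right _ _)
    nlinarith [show 0 < δ by positivity]
  have hδd : δ ≤ d / 2 := min_le_left _ _
  have hδ : 0 < δ := by positivity
  refine ⟨δ, hδ, fun t ht => ?_⟩
  obtain ⟨j, hj⟩ := exists_mem_Ico_of_dwell hd hτ ht
  have hle : ∀ r ∈ Ico (τ j) (τ (j + 1)), |t - r| ≤ δ → f t - ε ≤ f r := fun r hr htr => by
    have hlip : |f t - f r| ≤ K * |t - r| := (hf j).dist_le_mul t hj r hr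
    have hKr : K * |t - r| ≤ K * δ := by gcongr
    linarith [le_abs_self (f t - f r)]
  -- the interval containing `t` has length at least `2 * δ`, so there is room on one side of `t`
  rcases le_or_gt (t + δ) (τ (j + 1)) with hroom | hroom
  · exact ⟨t, ⟨by linarith, le_rfl⟩, fun r hr => hle r ⟨hj.1.trans hr.1, hr.2.trans_le hroom⟩
      (abs_le.2 ⟨by linarith [hr.2], by linarith [hr.1]⟩)⟩
  · refine ⟨t - δ, ⟨le_rfl, by linarith⟩, fun r hr => hle r ⟨?_, ?_⟩ (abs_le.2 ⟨?_, ?_⟩)⟩ <;>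
    linarith [hr.1, hr.2, hj.2, hτ j]

theorem exists_eqOn_Icc_of_chain {X : Type*} (hτ : StrictMono τ) {α : ℕ → ℝ → X}
    (hα : ∀ j, α j (τ (j + 1)) = α (j + 1) (τ (j + 1))) :
    ∃ y : ℝ → X, ∀ j, EqOn y (α j) (Icc (τ j) (τ (j + 1))) := by
  refine ⟨fun t => α (sInf {j | t ≤ τ (j + 1)}) t, fun j t ht => ?_⟩
  set m := sInf {j | t ≤ τ (j + 1)}
  have hm : t ≤ τ (m + 1) := Nat.sInf_mem (s := {j | t ≤ τ (j + 1)}) ⟨j, ht.2⟩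
  have hmj : m ≤ j := Nat.sInf_le ht.2
  rcases hmj.eq_or_lt with hmj | hmj
  · exact congrArg (α · t) hmj
  · have hjm : j = m + 1 := le_antisymm (hτ.le_iff_le.1 (ht.1.trans hm)) hmj
    have htm : t = τ (m + 1) := le_antisymm hm (hjm ▸ ht.1)
    rw [hjm]
    change α m t = _
    rw [htm, hα m]

end DwellTime

/-! ### Ordinary differential equations -/

section FiniteFamilies

variable {ι F : Type*} [Finite ι] [NormedAddCommGroup F]

theorem exists_forall_norm_le_of_isCompact {X : Type*} [TopologicalSpace X] {s : Set X}
    (hs : IsCompact s) {f : ι → X → F} (hf : ∀ l, ContinuousOn (f l) s) :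
    ∃ C, ∀ l, ∀ x ∈ s, ‖f l x‖ ≤ C := by
  choose B hB using fun l => hs.exists_bound_of_continuousOn (hf l)
  obtain ⟨C, hC⟩ := Finite.exists_le B
  exact ⟨C, fun l x hx => (hB l x hx).trans (hC l)⟩

theorem exists_forall_lipschitzOnWith_closedBall {E : Type*} [NormedAddCommGroup E]
    [NormedSpace ℝ E] [ProperSpace E] [NormedSpace ℝ F] {f : ι → E → F}
    (hf : ∀ l, ContDiff ℝ 1 (f l)) (C : ℝ) :
    ∃ K : NNReal, ∀ l, LipschitzOnWith K (f l) (Metric.closedBall 0 C) := by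
  choose K hK using fun l => (hf l).contDiffOn.exists_lipschitzOnWith one_ne_zero
    (convex_closedBall (0 : E) C) (isCompact_closedBall 0 C)
  obtain ⟨L, hL⟩ := Finite.exists_le K
  exact ⟨L, fun l => (hK l).weaken (hL l)⟩

end FiniteFamilies

theorem le_of_deriv_right_eq_mul_of_eq_zero {z g φ : ℝ → ℝ} {a T c G : ℝ} (hφ : ContDiff ℝ 1 φ)
    (hz : ContinuousOn z (Icc a T))
    (hz' : ∀ t ∈ Ico a T, HasDerivWithinAt z (g t * φ (z t)) (Ici t) t)
    (hg : ∀ t ∈ Ico a T, |g t| ≤ G) (ha : z a ≤ c) (hc : φ c = 0) :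
    ∀ t ∈ Icc a T, z t ≤ c := by
  intro t ht
  by_contra! hlt
  obtain ⟨s, hs, hzs⟩ : c ∈ z '' Icc a t :=
    intermediate_value_Icc ht.1 (hz.mono (Icc_subset_Icc_right ht.2)) ⟨ha, hlt.le⟩
  have hIcc : Icc s t ⊆ Icc a T := Icc_subset_Icc hs.1 ht.2
  have hIco : Ico s t ⊆ Ico a T := Ico_subset_Ico hs.1 ht.2
  obtain ⟨B, hB⟩ := isCompact_Icc.exists_bound_of_continuousOn (hz.mono hIcc)
  have hball : ∀ r ∈ Icc s t, z r ∈ Metric.closedBall 0 B := fun r hr => by simpa using hB r hr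
  obtain ⟨K, hK⟩ := exists_forall_lipschitzOnWith_closedBall (fun _ : Unit => hφ) B
  have hlip : ∀ r ∈ Ico s t,
      LipschitzOnWith (G.toNNReal * K) (fun w => g r * φ w) (Metric.closedBall 0 B) :=
    fun r hr => ((lipschitzWith_smul (g r)).weaken
      (NNReal.coe_le_coe.1 ((hg r (hIco hr)).trans G.le_coe_toNNReal))).comp_lipschitzOnWith (hK ())
  have hconst : EqOn z (fun _ => c) (Icc s t) :=
    ODE_solution_unique_of_mem_Icc_right hlip (hz.mono hIcc) (fun r hr => hz' r (hIco hr))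
      (fun r hr => hball r (Ico_subset_Icc_self hr)) continuousOn_const
      (fun r _ => by simpa [hc] using hasDerivWithinAt_const r (Ici r) c)
      (fun _ _ => hzs ▸ hball s (left_mem_Icc.2 hs.2)) hzs
  exact hlt.ne' (hconst (right_mem_Icc.2 hs.2))

theorem exists_le_mul_cos_eq (w z₀ : ℝ) : ∃ c, z₀ ≤ c ∧ c * Real.cos c = w := by
  obtain ⟨m, hm⟩ := exists_nat_ge (max z₀ |w|)
  set p : ℝ := m * (2 * Real.pi)
  have hmp : (m : ℝ) ≤ p := le_mul_of_one_le_right m.cast_nonneg (by linarith [Real.pi_gt_three])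
  have hw : |w| ≤ p := (le_max_right _ _).trans (hm.trans hmp)
  have hcos : Real.cos p = 1 := Real.cos_nat_mul_two_pi m
  have hcos' : Real.cos (p + Real.pi) = -1 := by rw [Real.cos_add_pi, hcos]
  have hpos := Real.pi_pos
  have hmem : w ∈ (fun c => c * Real.cos c) '' Icc p (p + Real.pi) := by
    refine intermediate_value_Icc' (by linarith) (by fun_prop) ⟨?_, ?_⟩
    · simp only [hcos']; linarith [neg_abs_le w]
    · simp only [hcos]; linarith [le_abs_self w]
  obtain ⟨c, hc, hcw⟩ := hmem
  exact ⟨c, (le_max_left _ _).trans (hm.trans (hmp.trans hc.1)), hcw⟩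

section Concatenation

variable {E : Type*} [NormedAddCommGroup E] [NormedSpace ℝ E]

theorem exists_forall_mem_Icc_hasDerivWithinAt_of_lipschitzWith [CompleteSpace E] {f : E → E}
    {K L : NNReal} (hK : LipschitzWith K f) (hL : ∀ y, ‖f y‖ ≤ L) {t₀ t₁ : ℝ} (ht : t₀ ≤ t₁)
    (y₀ : E) :
    ∃ α : ℝ → E, α t₀ = y₀ ∧ ∀ t ∈ Icc t₀ t₁, HasDerivWithinAt α (f (α t)) (Icc t₀ t₁) t := by
  have hPL : IsPicardLindelof (fun _ => f) (⟨t₀, left_mem_Icc.2 ht⟩ : Icc t₀ t₁) y₀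
      (L * (t₁ - t₀).toNNReal) 0 L K := by
    refine IsPicardLindelof.of_time_independent (fun y _ => hL y) hK.lipschitzOnWith ?_
    simp [ht]
  exact hPL.exists_eq_forall_mem_Icc_hasDerivWithinAt₀

variable {τ : ℕ → ℝ}

theorem exists_concatenation (hτ : StrictMono τ) {f : ℕ → E → E}
    (hf : ∀ j y₀, ∃ α : ℝ → E, α (τ j) = y₀ ∧
      ∀ t ∈ Icc (τ j) (τ (j + 1)), HasDerivWithinAt α (f j (α t)) (Icc (τ j) (τ (j + 1))) t)
    (y₀ : E) :
    ∃ y : ℝ → E, y (τ 0) = y₀ ∧ ∀ j, ∀ t ∈ Icc (τ j) (τ (j + 1)),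
      HasDerivWithinAt y (f j (y t)) (Icc (τ j) (τ (j + 1))) t := by
  choose α hα₀ hα using hf
  let p : ℕ → E := Nat.rec y₀ fun j yj => α j yj (τ (j + 1))
  obtain ⟨y, hy⟩ := exists_eqOn_Icc_of_chain hτ (α := fun j => α j (p j))
    fun j => (hα₀ (j + 1) (p (j + 1))).symm
  refine ⟨y, (hy 0 (left_mem_Icc.2 (hτ (Nat.lt_succ_self 0)).le)).trans (hα₀ 0 y₀), ?_⟩
  intro j t ht
  rw [hy j ht]
  exact (hα j (p j) t ht).congr (hy j) (hy j ht)

theorem continuousOn_Ici_of_forall_Icc_succ {X : Type*} [TopologicalSpace X] (hτ : Monotone τ)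
    (hτ' : Tendsto τ atTop atTop) {y : ℝ → X}
    (hy : ∀ j, ContinuousOn y (Icc (τ j) (τ (j + 1)))) : ContinuousOn y (Ici (τ 0)) := by
  have hIcc : ∀ j, ContinuousOn y (Icc (τ 0) (τ j)) := fun j => by
    induction j with
    | zero => simp
    | succ j ih =>
      rw [← Icc_union_Icc_eq_Icc (hτ j.zero_le) (hτ j.le_succ)]
      exact ih.union_of_isClosed (hy j) isClosed_Icc isClosed_Icc
  refine continuousOn_Ici_of_forall_Ico fun T => ?_
  obtain ⟨j, hj⟩ := (hτ'.eventually_ge_atTop T).exists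
  exact (hIcc j).mono fun t ht => ⟨ht.1, ht.2.le.trans hj⟩

end Concatenation

/-! ### Laplacians and basis bicomponents -/

section Graph

variable {N : ℕ} {A : Matrix (Fin N) (Fin N) ℝ}

theorem laplacian_mulVec (A : Matrix (Fin N) (Fin N) ℝ) (y : Fin N → ℝ) (i : Fin N) :
    (laplacian A).mulVec y i = ∑ k, A i k * (y i - y k) := by
  rw [laplacian, Matrix.sub_mulVec, Pi.sub_apply, Matrix.mulVec_diagonal, Finset.sum_mul]
  simp only [Matrix.mulVec, dotProduct, ← Finset.sum_sub_distrib, mul_sub]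

theorem eq_of_adj_of_laplacian_mulVec_eq_zero (hA : ∀ i k, 0 ≤ A i k) {y : Fin N → ℝ}
    {i k : Fin N} (hmax : ∀ j, (graphOf A).Adj j i → |y j| ≤ |y i|)
    (h0 : (laplacian A).mulVec y i = 0) (hk : (graphOf A).Adj k i) : y k = y i := by
  have hterm : ∀ j ∈ Finset.univ, 0 ≤ A i j * (y i * (y i - y j)) := by
    intro j _
    rcases (hA i j).eq_or_lt with hij | hij
    · simp [← hij]
    · have hij' : y i * y j ≤ y i * y i :=
        calc y i * y j ≤ |y i| * |y j| := (le_abs_self _).trans (abs_mul _ _).le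
          _ ≤ |y i| * |y i| := mul_le_mul_of_nonneg_left (hmax j hij) (abs_nonneg _)
          _ = y i * y i := abs_mul_abs_self _
      exact mul_nonneg hij.le (by linarith)
  have hsum : ∑ j, A i j * (y i * (y i - y j)) = 0 := by
    simp only [mul_left_comm _ (y i), ← Finset.mul_sum, ← laplacian_mulVec, h0, mul_zero]
  have hik := (Finset.sum_eq_zero_iff_of_nonneg hterm).1 hsum k (Finset.mem_univ k)
  rcases mul_eq_zero.1 ((mul_eq_zero.1 hik).resolve_left hk.ne') with hi | hi
  · simpa [hi] using hmax k hk
  · exact (sub_eq_zero.1 hi).symm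

theorem IsBasisBicomponent.apply_eq (hA : ∀ i k, 0 ≤ A i k) {S : Set (Fin N)}
    (hS : IsBasisBicomponent (graphOf A) S) {y : Fin N → ℝ}
    (h0 : ∀ i ∈ S, y i * (laplacian A).mulVec y i = 0) {i k : Fin N} (hi : i ∈ S) (hk : k ∈ S) :
    y i = y k := by
  obtain ⟨hne, hconn, hin⟩ := hS
  obtain ⟨m, hm, hmax⟩ := S.exists_max_image (|y ·|) S.toFinite hne
  have hstep : ∀ c d : S, (graphOf A).Adj c d → y d = y m → y c = y m := by
    intro c d hcd hd
    rcases mul_eq_zero.1 (h0 d d.2) with hd0 | hd0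
    · simpa [← hd, hd0] using hmax c c.2
    · exact (eq_of_adj_of_laplacian_mulVec_eq_zero hA
        (fun j hj => hd ▸ hmax j (hin j d d.2 hj)) hd0 hcd).trans hd
  have hall : ∀ p : S, y p = y m := by
    intro p
    rcases eq_or_ne p ⟨m, hm⟩ with rfl | hpm
    · rfl
    have hpath := hconn p ⟨m, hm⟩ hpm
    clear hpm
    induction hpath using Relation.TransGen.head_induction_on with
    | single h => exact hstep _ _ h rfl
    | head h _ ih => exact hstep _ _ h ih
  rw [hall ⟨i, hi⟩, hall ⟨k, hk⟩]

theorem tendsto_comp_of_isCompact {α X Y Z : Type*} [TopologicalSpace X] [TopologicalSpace Y]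
    [TopologicalSpace Z] [T2Space Z] {K : Set X} (hK : IsCompact K) {f : X → Y} {g : X → Z}
    (hf : Continuous f) (hg : Continuous g) {y₀ : Y} {z₀ : Z}
    (hfg : ∀ x ∈ K, g x = z₀ → f x = y₀) {l : Filter α} {u : α → X} (hu : ∀ᶠ t in l, u t ∈ K)
    (hgu : Tendsto (fun t => g (u t)) l (𝓝 z₀)) : Tendsto (fun t => f (u t)) l (𝓝 y₀) := by
  rw [(nhds_basis_opens y₀).tendsto_right_iff]
  rintro U ⟨hy₀, hU⟩
  have hclosed : IsClosed (g '' (K ∩ f ⁻¹' Uᶜ)) :=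
    ((hK.inter_right (hU.isClosed_compl.preimage hf)).image hg).isClosed
  have hz₀ : z₀ ∉ g '' (K ∩ f ⁻¹' Uᶜ) := by
    rintro ⟨x, ⟨hxK, hxU⟩, hx⟩
    exact hxU (hfg x hxK hx ▸ hy₀)
  filter_upwards [hu, hgu (hclosed.isOpen_compl.mem_nhds hz₀)] with t htK ht
  by_contra htU
  exact ht ⟨u t, ⟨htK, htU⟩, rfl⟩

theorem IsBasisBicomponent.tendsto_sub (hA : ∀ i k, 0 ≤ A i k) {S : Set (Fin N)}
    (hS : IsBasisBicomponent (graphOf A) S) {α : Type*} {l : Filter α} {y : α → Fin N → ℝ} {C : ℝ}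
    (hC : ∀ᶠ t in l, ‖y t‖ ≤ C)
    (h0 : ∀ i, Tendsto (fun t => y t i * (laplacian A).mulVec (y t) i) l (𝓝 0)) {i k : Fin N}
    (hi : i ∈ S) (hk : k ∈ S) : Tendsto (fun t => y t i - y t k) l (𝓝 0) :=
  tendsto_comp_of_isCompact (isCompact_closedBall (0 : Fin N → ℝ) C)
    (f := fun w => w i - w k) (g := fun w j => w j * (laplacian A).mulVec w j)
    (by fun_prop) (by simp only [laplacian_mulVec]; fun_prop)
    (fun _ _ hw => sub_eq_zero.2 (hS.apply_eq hA (fun j _ => congrFun hw j) hi hk))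
    (hC.mono fun t ht => by simpa using ht) (tendsto_pi_nhds.2 h0)

theorem JointlyStronglyConnectedBasis.tendsto_sub {V ι α : Type*} {G : ι → Digraph V}
    (hG : JointlyStronglyConnectedBasis G) {l : Filter α} {x : V → α → ℝ}
    (hx : ∀ j S, IsBasisBicomponent (G j) S → ∀ i ∈ S, ∀ k ∈ S,
      Tendsto (fun t => x i t - x k t) l (𝓝 0)) (i k : V) :
    Tendsto (fun t => x i t - x k t) l (𝓝 0) := by
  rcases eq_or_ne i k with rfl | hik
  · simpa using tendsto_const_nhds
  have hpath := hG.2 i k hik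
  clear hik
  induction hpath using Relation.TransGen.trans_induction_on with
  | single h =>
    obtain ⟨j, S, hS, hi, hk, -⟩ := h
    exact hx j S hS _ hi _ hk
  | trans _ _ ih₁ ih₂ => simpa using ih₁.add ih₂

end Graph

/-! ### Switching topologies -/

namespace SwitchingTopology

open MeasureTheory

variable {N M : ℕ} {A : Fin M → Matrix (Fin N) (Fin N) ℝ} {τ : ℕ → ℝ} {n : ℕ → Fin M}
  {a : ℝ → Matrix (Fin N) (Fin N) ℝ}

theorem strictMono (h : SwitchingTopology A τ n a) : StrictMono τ := by
  obtain ⟨τmin, hpos, hdwell⟩ := h.dwell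
  exact strictMono_nat_of_lt_succ fun j => by linarith [hdwell j]

theorem nonneg (h : SwitchingTopology A τ n a) (j : ℕ) : 0 ≤ τ j :=
  h.start.symm.trans_le (h.strictMono.monotone j.zero_le)

theorem tendsto_atTop (h : SwitchingTopology A τ n a) : Tendsto τ atTop atTop :=
  let ⟨_, hpos, hdwell⟩ := h.dwell
  tendsto_atTop_of_dwell hpos fun j => (hdwell j).le

theorem exists_mem_Ico (h : SwitchingTopology A τ n a) {t : ℝ} (ht : 0 ≤ t) :
    ∃ j, t ∈ Ico (τ j) (τ (j + 1)) :=
  let ⟨_, hpos, hdwell⟩ := h.dwell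
  exists_mem_Ico_of_dwell hpos (fun j => (hdwell j).le) (h.start.trans_le ht)

theorem exists_eq (h : SwitchingTopology A τ n a) {t : ℝ} (ht : 0 ≤ t) : ∃ l, a t = A l :=
  let ⟨j, hj⟩ := h.exists_mem_Ico ht
  ⟨n j, h.active j t hj⟩

theorem eventually_eq_right (h : SwitchingTopology A τ n a) {t : ℝ} (ht : 0 ≤ t) :
    ∀ᶠ s in 𝓝[≥] t, a s = a t := by
  obtain ⟨j, hj⟩ := h.exists_mem_Ico ht
  filter_upwards [Ico_mem_nhdsGE hj.2] with s hs
  rw [h.active j t hj, h.active j s ⟨hj.1.trans hs.1, hs.2⟩]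

theorem exists_mem_Ioo (h : SwitchingTopology A τ n a) {t : ℝ} (ht : 0 ≤ t)
    (htτ : t ∉ range τ) : ∃ j, t ∈ Ioo (τ j) (τ (j + 1)) :=
  let ⟨j, hj⟩ := h.exists_mem_Ico ht
  ⟨j, hj.1.lt_of_ne fun hτt => htτ ⟨j, hτt⟩, hj.2⟩

theorem eventually_eq (h : SwitchingTopology A τ n a) {t : ℝ} (ht : 0 ≤ t) (htτ : t ∉ range τ) :
    ∀ᶠ s in 𝓝 t, a s = a t := by
  obtain ⟨j, hj⟩ := h.exists_mem_Ioo ht htτ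
  filter_upwards [Ioo_mem_nhds hj.1 hj.2] with s hs
  rw [h.active j t (Ioo_subset_Ico_self hj), h.active j s (Ioo_subset_Ico_self hs)]

theorem eventually_right_notMem_range (h : SwitchingTopology A τ n a) {t : ℝ} (ht : 0 ≤ t) :
    ∀ᶠ s in 𝓝[>] t, s ∉ range τ := by
  obtain ⟨j, hj⟩ := h.exists_mem_Ico ht
  filter_upwards [Ioo_mem_nhdsGT hj.2] with s hs
  rintro ⟨m, rfl⟩
  have hjm : j < m := h.strictMono.lt_iff_lt.1 (hj.1.trans_lt hs.1)
  have hmj : m < j + 1 := h.strictMono.lt_iff_lt.1 hs.2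
  omega

theorem dwell_le_sub (h : SwitchingTopology A τ n a) {d s t : ℝ}
    (hd : ∀ j, d < τ (j + 1) - τ j) (hs : s ∈ range τ) (ht : t ∈ range τ) (hst : s < t) :
    d ≤ t - s := by
  obtain ⟨i, rfl⟩ := hs
  obtain ⟨j, rfl⟩ := ht
  have hij : i + 1 ≤ j := h.strictMono.lt_iff_lt.1 hst
  linarith [h.strictMono.monotone hij, hd i]

theorem exists_active (h : SwitchingTopology A τ n a) (l : Fin M) :
    ∃ (s : ℝ → ℝ) (D : ℝ), ∀ᶠ t in atTop,
      (t ≤ s t ∧ s t ≤ t + D) ∧ laplacian (a (s t)) = laplacian (A l) := by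
  obtain ⟨Ta, Td, τmax, hmax, hrange, hlt, hact, hgap⟩ := h.reactivation l
  obtain ⟨τmin, hpos, hdwell⟩ := h.dwell
  have hTa : ∀ ν, τmin ≤ Ta (ν + 1) - Ta ν := fun ν =>
    h.dwell_le_sub hdwell (hrange ν).1 (hrange (ν + 1)).1 ((hlt ν).1.trans_le (hlt ν).2)
  have hex : ∀ t, Ta 0 ≤ t →
      ∃ s, (t ≤ s ∧ s ≤ t + τmax) ∧ laplacian (a s) = laplacian (A l) := by
    intro t ht
    obtain ⟨ν, hν⟩ := exists_mem_Ico_of_dwell hpos hTa ht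
    rcases lt_or_ge t (Td ν) with htd | htd
    · exact ⟨t, ⟨le_rfl, by linarith⟩, hact ν t ⟨hν.1, htd⟩⟩
    · exact ⟨Ta (ν + 1), ⟨hν.2.le, by linarith [hgap ν]⟩,
        hact (ν + 1) _ ⟨le_rfl, (hlt (ν + 1)).1⟩⟩
  choose! s hs using hex
  exact ⟨s, τmax, (eventually_ge_atTop (Ta 0)).mono hs⟩

theorem exists_forall_norm_le_comp {E F : Type*} [NormedAddCommGroup E] [ProperSpace E]
    [NormedAddCommGroup F] (h : SwitchingTopology A τ n a)
    {Φ : Matrix (Fin N) (Fin N) ℝ → E → F} (hΦ : ∀ l, Continuous (Φ (A l))) {y : ℝ → E} {C : ℝ}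
    (hy : ∀ t, 0 ≤ t → ‖y t‖ ≤ C) : ∃ B, ∀ t, 0 ≤ t → ‖Φ (a t) (y t)‖ ≤ B := by
  obtain ⟨B, hB⟩ := exists_forall_norm_le_of_isCompact (isCompact_closedBall (0 : E) C)
    fun l => (hΦ l).continuousOn
  refine ⟨B, fun t ht => ?_⟩
  obtain ⟨l, hl⟩ := h.exists_eq ht
  rw [hl]
  exact hB l _ (by simpa using hy t ht)

theorem exists_lipschitzOnWith_comp {E F : Type*} [NormedAddCommGroup E] [NormedSpace ℝ E]
    [ProperSpace E] [NormedAddCommGroup F] [NormedSpace ℝ F] (h : SwitchingTopology A τ n a)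
    {Φ : Matrix (Fin N) (Fin N) ℝ → E → F} (hΦ : ∀ l, ContDiff ℝ 1 (Φ (A l))) {y : ℝ → E} {C : ℝ}
    (hy : ∀ t, 0 ≤ t → ‖y t‖ ≤ C) {L : NNReal} (hL : LipschitzOnWith L y (Ici 0)) :
    ∃ K : NNReal, ∀ j, LipschitzOnWith K (fun t => Φ (a t) (y t)) (Ico (τ j) (τ (j + 1))) := by
  obtain ⟨K, hK⟩ := exists_forall_lipschitzOnWith_closedBall hΦ C
  refine ⟨K * L, fun j => ?_⟩
  have hsub : Ico (τ j) (τ (j + 1)) ⊆ Ici 0 := fun t ht => (h.nonneg j).trans ht.1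
  have hmaps : MapsTo y (Ico (τ j) (τ (j + 1))) (Metric.closedBall 0 C) := fun t ht => by
    simpa using hy t (hsub ht)
  intro s hs t ht
  simpa only [h.active j s hs, h.active j t ht, Function.comp_apply] using
    ((hK (n j)).comp (hL.mono hsub) hmaps) hs ht

variable {G : Matrix (Fin N) (Fin N) ℝ → ℝ → ℝ} {T : ℝ}

theorem intervalIntegrable (h : SwitchingTopology A τ n a) (hT : 0 ≤ T)
    (hG : ∀ l, ContinuousOn (G (A l)) (Icc 0 T)) :
    IntervalIntegrable (fun s => G (a s) s) volume 0 T := by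
  rw [intervalIntegrable_iff_integrableOn_Ioc_of_le hT]
  obtain ⟨B, hB⟩ := exists_forall_norm_le_of_isCompact isCompact_Icc hG
  refine IntegrableOn.of_bound (by simp) ?_ B ?_
  · have hae : (Ioc 0 T \ range τ : Set ℝ) =ᵐ[volume] Ioc 0 T :=
      sdiff_null_ae_eq_self ((countable_range τ).measure_zero volume)
    rw [← Measure.restrict_congr_set hae]
    refine ContinuousOn.aestronglyMeasurable (fun t ht => ?_)
      (measurableSet_Ioc.diff (countable_range τ).measurableSet)
    obtain ⟨l, hl⟩ := h.exists_eq ht.1.1.le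
    have hcont := (hG l t (Ioc_subset_Icc_self ht.1)).mono
      (sdiff_subset.trans Ioc_subset_Icc_self : Ioc 0 T \ range τ ⊆ Icc 0 T)
    refine hcont.congr_of_eventuallyEq ?_ (by rw [hl])
    filter_upwards [mem_nhdsWithin_of_mem_nhds (h.eventually_eq ht.1.1.le ht.2)] with s hs
    rw [hs, hl]
  · refine (ae_restrict_iff' measurableSet_Ioc).2 (Eventually.of_forall fun t ht => ?_)
    obtain ⟨l, hl⟩ := h.exists_eq ht.1.le
    rw [hl]
    exact hB l t (Ioc_subset_Icc_self ht)

theorem continuousWithinAt_Ici (h : SwitchingTopology A τ n a)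
    (hG : ∀ l, ContinuousOn (G (A l)) (Ico 0 T)) {t : ℝ} (ht : t ∈ Ico 0 T) :
    ContinuousWithinAt (fun s => G (a s) s) (Ici t) t := by
  obtain ⟨l, hl⟩ := h.exists_eq ht.1
  have hcont : ContinuousWithinAt (G (A l)) (Ici t) t := (hG l t ht).mono_of_mem_nhdsWithin
    (mem_of_superset (Ico_mem_nhdsGE ht.2) (Ico_subset_Ico_left ht.1))
  refine hcont.congr_of_eventuallyEq ?_ (by rw [hl])
  filter_upwards [h.eventually_eq_right ht.1] with s hs
  rw [hs, hl]

theorem hasDerivWithinAt_integral (h : SwitchingTopology A τ n a)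
    (hG : ∀ l, ContinuousOn (G (A l)) (Ico 0 T)) {t : ℝ} (ht : t ∈ Ico 0 T) :
    HasDerivWithinAt (fun t => ∫ s in (0 : ℝ)..t, G (a s) s) (G (a t) t) (Ici t) t := by
  obtain ⟨T', hT'⟩ := exists_between ht.2
  have hint : ∀ r, 0 ≤ r → r < T → IntervalIntegrable (fun s => G (a s) s) volume 0 r :=
    fun r hr hrT => h.intervalIntegrable hr fun l =>
      (hG l).mono fun s hs => ⟨hs.1, hs.2.trans_lt hrT⟩
  have h0 : 0 ≤ T' := ht.1.trans hT'.1.le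
  exact intervalIntegral.integral_hasDerivWithinAt_right (t := Ioi t) (hint t ht.1 ht.2)
    ⟨Ioc 0 T', mem_of_superset (Ioc_mem_nhdsGT hT'.1) (Ioc_subset_Ioc_left ht.1),
      ((intervalIntegrable_iff_integrableOn_Ioc_of_le h0).1
        (hint T' h0 hT'.2)).aestronglyMeasurable⟩
    ((h.continuousWithinAt_Ici hG ht).mono Ioi_subset_Ici_self)

theorem continuousOn_integral (h : SwitchingTopology A τ n a)
    (hG : ∀ l, ContinuousOn (G (A l)) (Ico 0 T)) :
    ContinuousOn (fun t => ∫ s in (0 : ℝ)..t, G (a s) s) (Ico 0 T) := by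
  intro t ht
  obtain ⟨T', hT'⟩ := exists_between ht.2
  have h0 : 0 ≤ T' := ht.1.trans hT'.1.le
  have hint := h.intervalIntegrable h0 fun l =>
    (hG l).mono fun s hs => ⟨hs.1, hs.2.trans_lt hT'.2⟩
  have hprim := intervalIntegral.continuousOn_primitive_interval' hint left_mem_uIcc
  rw [uIcc_of_le h0] at hprim
  refine (hprim t ⟨ht.1, hT'.1.le⟩).mono_of_mem_nhdsWithin ?_
  filter_upwards [self_mem_nhdsWithin, mem_nhdsWithin_of_mem_nhds (Iio_mem_nhds hT'.1)]
    with s hs hsT'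
  exact ⟨hs.1, (mem_Iio.1 hsT').le⟩

theorem hasDerivWithinAt_Ici (h : SwitchingTopology A τ n a) {x f : ℝ → ℝ}
    (hx : ContinuousOn x (Ico 0 T)) (hd : ∀ s ∈ Ico 0 T, s ∉ range τ → HasDerivAt x (f s) s)
    {t : ℝ} (ht : t ∈ Ico 0 T) (hf : ContinuousWithinAt f (Ici t) t) :
    HasDerivWithinAt x (f t) (Ici t) t := by
  obtain ⟨c, hc, hsub⟩ := (mem_nhdsGT_iff_exists_Ioo_subset).1
    (inter_mem (h.eventually_right_notMem_range ht.1) (Ioo_mem_nhdsGT ht.2))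
  have hderiv : ∀ s ∈ Ioo t c, HasDerivAt x (f s) s := fun s hs =>
    hd s ⟨ht.1.trans hs.1.le, (hsub hs).2.2⟩ (hsub hs).1
  have hmem : Ioo t c ∈ 𝓝[>] t := Ioo_mem_nhdsGT hc
  refine hasDerivWithinAt_Ici_of_tendsto_deriv (s := Ioo t c)
    (fun s hs => (hderiv s hs).differentiableAt.differentiableWithinAt)
    ((hx t ht).mono fun s hs => ⟨ht.1.trans hs.1.le, (hsub hs).2.2⟩) hmem ?_
  refine (hf.mono Ioi_subset_Ici_self).tendsto.congr' ?_
  filter_upwards [hmem] with s hs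
  exact (hderiv s hs).deriv.symm

end SwitchingTopology

/-! ### The closed loop as a switched autonomous system -/

/-- The components of the augmented state of an agent: position, velocity, and the two integrals
`∫ qᵢ rᵢ` and `λ₁ ∫ qᵢ² rᵢ² + ∫ vᵢ²` in terms of which `Rᵢ` is a function of the state. -/
inductive Coord
  | pos
  | vel
  | corr
  | energy
  deriving DecidableEq

instance : Fintype Coord := ⟨{.pos, .vel, .corr, .energy}, fun m => by cases m <;> decide⟩

/-- The augmented states of the closed loop, in which the integral terms of the controller are
coordinates, so that the closed loop is an autonomous system as long as the topology is fixed. -/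
abbrev State (N : ℕ) := Coord → Fin N → ℝ

namespace State

noncomputable section

variable {N : ℕ}

/-- The quantity `qᵢ` as a function of the augmented state. -/
def q (ρ : ℝ) (y : State N) (i : Fin N) : ℝ := y .vel i + ρ * y .pos i

/-- The quantity `rᵢ` as a function of the augmented state and the adjacency matrix. -/
def r (ρ : ℝ) (A : Matrix (Fin N) (Fin N) ℝ) (y : State N) (i : Fin N) : ℝ :=
  ∑ k, A i k * (y .vel i - y .vel k) + ρ * ∑ k, A i k * (y .pos i - y .pos k)

/-- The nonlinear PI function `Rᵢ` as a function of the augmented state. -/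
def R (ρ l₂ : ℝ) (y : State N) (i : Fin N) : ℝ :=
  1 / 2 * q ρ y i ^ 2 + ρ / 2 * y .pos i ^ 2 + y .energy i + l₂ / 2 * y .corr i ^ 2

/-- The factor of the control input that multiplies `Rᵢ cos Rᵢ`. -/
def gain (ρ l₁ l₂ : ℝ) (A : Matrix (Fin N) (Fin N) ℝ) (y : State N) (i : Fin N) : ℝ :=
  (ρ + 1) * y .vel i + r ρ A y i * (l₁ * (q ρ y i * r ρ A y i) + l₂ * y .corr i)

/-- The control input `uᵢ` as a function of the augmented state and the adjacency matrix. -/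
def u (ρ l₁ l₂ : ℝ) (A : Matrix (Fin N) (Fin N) ℝ) (y : State N) (i : Fin N) : ℝ :=
  R ρ l₂ y i * Real.cos (R ρ l₂ y i) * gain ρ l₁ l₂ A y i

/-- The vector field of the closed loop with the fixed adjacency matrix `A`. -/
def field (b : Fin N → ℝ) (ρ l₁ l₂ : ℝ) (A : Matrix (Fin N) (Fin N) ℝ) (y : State N) : State N
  | .pos, i => y .vel i
  | .vel, i => b i * u ρ l₁ l₂ A y i
  | .corr, i => q ρ y i * r ρ A y i
  | .energy, i => l₁ * (q ρ y i ^ 2 * r ρ A y i ^ 2) + y .vel i ^ 2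

/-- The curve `y` follows the closed-loop vector field on the time interval `J` (of the form
`[0, T)` or `[0, ∞)`), with the adjacency matrix `a t` and at the speed `χ t`. Speeds other than `1`
arise when the vector field is cut off. -/
structure IsTrajectory (b : Fin N → ℝ) (ρ l₁ l₂ : ℝ) (a : ℝ → Matrix (Fin N) (Fin N) ℝ)
    (χ : ℝ → ℝ) (J : Set ℝ) (y : ℝ → State N) : Prop where
  continuousOn : ContinuousOn y J
  deriv : ∀ t ∈ J, HasDerivWithinAt y (χ t • field b ρ l₁ l₂ (a t) (y t)) (Ici t) t

theorem contDiff_coord (m : Coord) (i : Fin N) : ContDiff ℝ 1 fun y : State N => y m i :=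
  contDiff_pi.1 (contDiff_pi.1 contDiff_id m) i

@[fun_prop]
theorem contDiff_q (ρ : ℝ) (i : Fin N) : ContDiff ℝ 1 fun y : State N => q ρ y i := by
  unfold q; fun_prop

@[fun_prop]
theorem contDiff_r (ρ : ℝ) (A : Matrix (Fin N) (Fin N) ℝ) (i : Fin N) :
    ContDiff ℝ 1 fun y : State N => r ρ A y i := by
  unfold r; fun_prop

@[fun_prop]
theorem contDiff_R (ρ l₂ : ℝ) (i : Fin N) : ContDiff ℝ 1 fun y : State N => R ρ l₂ y i := by
  unfold R; fun_prop

@[fun_prop]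
theorem contDiff_gain (ρ l₁ l₂ : ℝ) (A : Matrix (Fin N) (Fin N) ℝ) (i : Fin N) :
    ContDiff ℝ 1 fun y : State N => gain ρ l₁ l₂ A y i := by
  unfold gain; fun_prop

@[fun_prop]
theorem contDiff_u (ρ l₁ l₂ : ℝ) (A : Matrix (Fin N) (Fin N) ℝ) (i : Fin N) :
    ContDiff ℝ 1 fun y : State N => u ρ l₁ l₂ A y i := by
  unfold u; fun_prop

theorem contDiff_field (b : Fin N → ℝ) (ρ l₁ l₂ : ℝ) (A : Matrix (Fin N) (Fin N) ℝ) :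
    ContDiff ℝ 1 (field b ρ l₁ l₂ A) := by
  refine contDiff_pi.2 fun m => contDiff_pi.2 fun i => ?_
  cases m <;> simp only [field] <;> fun_prop

theorem r_eq_laplacian_mulVec (ρ : ℝ) (A : Matrix (Fin N) (Fin N) ℝ) (y : State N) (i : Fin N) :
    r ρ A y i = (laplacian A).mulVec (q ρ y) i := by
  rw [laplacian_mulVec, r, Finset.mul_sum, ← Finset.sum_add_distrib]
  exact Finset.sum_congr rfl fun k _ => by simp only [q]; ring

theorem abs_vel_le_of_q_sq_le {ρ c : ℝ} (hρ : 0 ≤ ρ) {y : State N} {i : Fin N}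
    (hq : q ρ y i ^ 2 ≤ c) (hx : ρ * y .pos i ^ 2 ≤ c) : |y .vel i| ≤ 2 * c + 1 + ρ := by
  have hv : y .vel i = q ρ y i - ρ * y .pos i := by simp [q]
  rw [hv, abs_le]
  constructor <;> nlinarith [sq_nonneg (q ρ y i - 1), sq_nonneg (q ρ y i + 1),
    mul_nonneg hρ (sq_nonneg (y .pos i - 1)), mul_nonneg hρ (sq_nonneg (y .pos i + 1))]

theorem exists_forall_abs_le_of_R_le {ρ l₂ : ℝ} (hρ : 0 < ρ) (hl₂ : 0 < l₂) (c : ℝ) :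
    ∃ K, ∀ (y : State N) (i : Fin N), 0 ≤ y .energy i → R ρ l₂ y i ≤ c → ∀ m, |y m i| ≤ K := by
  refine ⟨2 * c / ρ + 1 + (4 * c + 1 + ρ) + (2 * c / l₂ + 1), fun y i he hR m => ?_⟩
  have abs_le_sq_add_one : ∀ z : ℝ, |z| ≤ z ^ 2 + 1 := fun z => by
    nlinarith [sq_abs z, sq_nonneg (|z| - 1), abs_nonneg z]
  unfold R at hR
  have hq : 0 ≤ q ρ y i ^ 2 := sq_nonneg _
  have hx : 0 ≤ ρ * y .pos i ^ 2 := by positivity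
  have hw : 0 ≤ l₂ * y .corr i ^ 2 := by positivity
  have hc : 0 ≤ c := by linarith
  have hcρ : 0 ≤ 2 * c / ρ := by positivity
  have hcl : 0 ≤ 2 * c / l₂ := by positivity
  cases m with
  | pos =>
    have hpos : y .pos i ^ 2 ≤ 2 * c / ρ := by rw [le_div_iff₀ hρ]; linarith
    linarith [abs_le_sq_add_one (y .pos i)]
  | vel =>
    have hvel := abs_vel_le_of_q_sq_le (c := 2 * c) hρ.le (by linarith : q ρ y i ^ 2 ≤ _)
      (by linarith)
    linarith
  | corr =>
    have hcorr : y .corr i ^ 2 ≤ 2 * c / l₂ := by rw [le_div_iff₀ hl₂]; linarith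
    linarith [abs_le_sq_add_one (y .corr i)]
  | energy =>
    rw [abs_of_nonneg he]
    linarith

variable {M : ℕ} {A : Fin M → Matrix (Fin N) (Fin N) ℝ} {b : Fin N → ℝ} {ρ l₁ l₂ : ℝ}
  {a : ℝ → Matrix (Fin N) (Fin N) ℝ} {χ : ℝ → ℝ} {J : Set ℝ} {T : ℝ} {y : ℝ → State N}

theorem field_energy_nonneg (hl₁ : 0 ≤ l₁) (B : Matrix (Fin N) (Fin N) ℝ) (z : State N)
    (i : Fin N) : 0 ≤ field b ρ l₁ l₂ B z .energy i := by
  simp only [field]; positivity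

namespace IsTrajectory

theorem mono {J' : Set ℝ} (h : IsTrajectory b ρ l₁ l₂ a χ J y) (hJ : J' ⊆ J) :
    IsTrajectory b ρ l₁ l₂ a χ J' y :=
  ⟨h.continuousOn.mono hJ, fun t ht => h.deriv t (hJ ht)⟩

theorem deriv_coord (h : IsTrajectory b ρ l₁ l₂ a χ J y) {t : ℝ} (ht : t ∈ J) (m : Coord)
    (i : Fin N) :
    HasDerivWithinAt (fun t => y t m i) (χ t * field b ρ l₁ l₂ (a t) (y t) m i) (Ici t) t :=
  hasDerivWithinAt_pi.1 (hasDerivWithinAt_pi.1 (h.deriv t ht) m) i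

theorem continuousOn_comp (h : IsTrajectory b ρ l₁ l₂ a χ J y) {F : State N → ℝ}
    (hF : ContDiff ℝ 1 F) : ContinuousOn (fun t => F (y t)) J :=
  hF.continuous.comp_continuousOn h.continuousOn

theorem deriv_R (h : IsTrajectory b ρ l₁ l₂ a χ J y) {t : ℝ} (ht : t ∈ J) (i : Fin N) :
    HasDerivWithinAt (fun t => R ρ l₂ (y t) i)
      ((χ t * (q ρ (y t) i * gain ρ l₁ l₂ (a t) (y t) i)) *
        (1 + b i * (R ρ l₂ (y t) i * Real.cos (R ρ l₂ (y t) i)))) (Ici t) t := by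
  have hx := h.deriv_coord ht .pos i
  have hv := h.deriv_coord ht .vel i
  have hw := h.deriv_coord ht .corr i
  have he := h.deriv_coord ht .energy i
  have hq := hv.add (hx.const_mul ρ)
  have hR := ((((hq.pow 2).const_mul (1 / 2)).add ((hx.pow 2).const_mul (ρ / 2))).add he).add
    ((hw.pow 2).const_mul (l₂ / 2))
  refine hR.congr_deriv ?_
  simp [field, gain, u, q]
  ring

theorem energy_nonneg (h : IsTrajectory b ρ l₁ l₂ a χ (Ico 0 T) y) (hl₁ : 0 ≤ l₁)
    (hχ : ∀ t, 0 ≤ χ t) {i : Fin N} (h0 : 0 ≤ y 0 .energy i) {t : ℝ} (ht : t ∈ Ico 0 T) :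
    0 ≤ y t .energy i := by
  refine h0.trans (monotoneOn_of_deriv_right_nonneg
    ((h.continuousOn_comp (contDiff_coord .energy i)).mono (Icc_subset_Ico_right ht.2))
    (fun s hs => h.deriv_coord ⟨hs.1, hs.2.trans ht.2⟩ .energy i)
    (fun s _ => mul_nonneg (hχ s) (field_energy_nonneg hl₁ _ _ i))
    ⟨le_rfl, ht.1⟩ ⟨ht.1, le_rfl⟩ ht.1)

theorem R_le (h : IsTrajectory b ρ l₁ l₂ a χ (Ico 0 T) y) (ha : ∀ t, 0 ≤ t → ∃ l, a t = A l)
    (hχ : ∀ t, |χ t| ≤ 1) {i : Fin N} {c : ℝ} (h0 : R ρ l₂ (y 0) i ≤ c)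
    (hc : 1 + b i * (c * Real.cos c) = 0) {t : ℝ} (ht : t ∈ Ico 0 T) :
    R ρ l₂ (y t) i ≤ c := by
  have hsub : Icc 0 t ⊆ Ico 0 T := Icc_subset_Ico_right ht.2
  obtain ⟨G, hG⟩ := exists_forall_norm_le_of_isCompact (isCompact_Icc (a := 0) (b := t)) fun l =>
    (h.continuousOn_comp ((contDiff_q ρ i).mul (contDiff_gain ρ l₁ l₂ (A l) i))).mono hsub
  refine le_of_deriv_right_eq_mul_of_eq_zero (G := G) (φ := fun z => 1 + b i * (z * Real.cos z))
    (by fun_prop) ((h.continuousOn_comp (contDiff_R ρ l₂ i)).mono hsub)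
    (fun s hs => h.deriv_R (hsub (Ico_subset_Icc_self hs)) i) (fun s hs => ?_) h0 hc t
    ⟨ht.1, le_rfl⟩
  obtain ⟨l, hl⟩ := ha s hs.1
  rw [abs_mul, hl]
  exact (mul_le_of_le_one_left (abs_nonneg _) (hχ s)).trans (hG l s (Ico_subset_Icc_self hs))

theorem exists_bound (hb : ∀ i, b i ≠ 0) (hρ : 0 < ρ) (hl₁ : 0 ≤ l₁) (hl₂ : 0 < l₂)
    (ha : ∀ t, 0 ≤ t → ∃ l, a t = A l) (y₀ : State N) (h₀ : 0 ≤ y₀ .energy) :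
    ∃ K : ℝ, ∀ (χ : ℝ → ℝ) (T : ℝ) (y : ℝ → State N), (∀ t, χ t ∈ Icc 0 1) →
      IsTrajectory b ρ l₁ l₂ a χ (Ico 0 T) y → y 0 = y₀ → ∀ t ∈ Ico 0 T, ‖y t‖ ≤ K := by
  choose c hRc hc using fun i => exists_le_mul_cos_eq (-1 / b i) (R ρ l₂ y₀ i)
  choose B hB using fun i => exists_forall_abs_le_of_R_le (N := N) hρ hl₂ (c i)
  obtain ⟨K, hK⟩ := Finite.exists_le B
  refine ⟨max K 0, fun χ T y hχ hy hy₀ t ht => ?_⟩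
  refine (pi_norm_le_iff_of_nonneg (le_max_right _ _)).2 fun m =>
    (pi_norm_le_iff_of_nonneg (le_max_right _ _)).2 fun i => ?_
  have henergy : 0 ≤ y t .energy i :=
    hy.energy_nonneg hl₁ (fun t => (hχ t).1) (by rw [hy₀]; exact h₀ i) ht
  have hR : R ρ l₂ (y t) i ≤ c i := by
    refine hy.R_le ha (fun t => ?_) (by rw [hy₀]; exact hRc i) ?_ ht
    · rw [abs_of_nonneg (hχ t).1]
      exact (hχ t).2
    · rw [hc i, mul_div_cancel₀ _ (hb i)]
      norm_num
  exact (hB i (y t) i henergy hR m).trans ((hK i).trans (le_max_left _ _))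

theorem eqOn (ha : ∀ t, 0 ≤ t → ∃ l, a t = A l) {y' : ℝ → State N}
    (h : IsTrajectory b ρ l₁ l₂ a (fun _ => 1) (Ico 0 T) y)
    (h' : IsTrajectory b ρ l₁ l₂ a (fun _ => 1) (Ico 0 T) y') (h0 : y 0 = y' 0) :
    EqOn y y' (Ico 0 T) := by
  intro t ht
  have hsub : Icc 0 t ⊆ Ico 0 T := Icc_subset_Ico_right ht.2
  obtain ⟨C, hC⟩ := isCompact_Icc.exists_bound_of_continuousOn (h.continuousOn.mono hsub)
  obtain ⟨C', hC'⟩ := isCompact_Icc.exists_bound_of_continuousOn (h'.continuousOn.mono hsub)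
  obtain ⟨K, hK⟩ := exists_forall_lipschitzOnWith_closedBall
    (fun l => contDiff_field b ρ l₁ l₂ (A l)) (max C C')
  refine ODE_solution_unique_of_mem_Icc_right (v := fun t => field b ρ l₁ l₂ (a t))
    (s := fun _ => Metric.closedBall 0 (max C C')) (K := K) (fun s hs => ?_)
    (h.continuousOn.mono hsub) (fun s hs => ?_) (fun s hs => ?_)
    (h'.continuousOn.mono hsub) (fun s hs => ?_) (fun s hs => ?_) h0 ⟨ht.1, le_rfl⟩
  · obtain ⟨l, hl⟩ := ha s hs.1
    rw [hl]
    exact hK l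
  · simpa using h.deriv s (hsub (Ico_subset_Icc_self hs))
  · simpa using Or.inl (hC s (Ico_subset_Icc_self hs))
  · simpa using h'.deriv s (hsub (Ico_subset_Icc_self hs))
  · simpa using Or.inr (hC' s (Ico_subset_Icc_self hs))

end IsTrajectory

end

end State

/-! ### Asymptotics of global trajectories -/

namespace State.IsTrajectory

variable {N M : ℕ} {A : Fin M → Matrix (Fin N) (Fin N) ℝ} {τ : ℕ → ℝ} {n : ℕ → Fin M}
  {a : ℝ → Matrix (Fin N) (Fin N) ℝ} {b : Fin N → ℝ} {ρ l₁ l₂ K : ℝ} {y : ℝ → State N}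

theorem deriv_coord_Ici (h : IsTrajectory b ρ l₁ l₂ a (fun _ => 1) (Ici 0) y) {t : ℝ}
    (ht : 0 ≤ t) (m : Coord) (i : Fin N) :
    HasDerivWithinAt (fun t => y t m i) (field b ρ l₁ l₂ (a t) (y t) m i) (Ici t) t := by
  simpa only [one_mul] using h.deriv_coord (mem_Ici.2 ht) m i

theorem exists_lipschitzOnWith (h : IsTrajectory b ρ l₁ l₂ a (fun _ => 1) (Ici 0) y)
    (htop : SwitchingTopology A τ n a) (hK : ∀ t, 0 ≤ t → ‖y t‖ ≤ K) :
    ∃ L : NNReal, LipschitzOnWith L y (Ici 0) := by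
  obtain ⟨B, hB⟩ := htop.exists_forall_norm_le_comp
    (fun l => (contDiff_field b ρ l₁ l₂ (A l)).continuous) hK
  exact ⟨B.toNNReal, lipschitzOnWith_Ici_of_norm_deriv_right_le h.continuousOn
    (fun t ht => by simpa only [one_smul] using h.deriv t ht)
    fun t ht => (hB t ht).trans (Real.le_coe_toNNReal B)⟩

theorem tendsto_field_energy (h : IsTrajectory b ρ l₁ l₂ a (fun _ => 1) (Ici 0) y)
    (htop : SwitchingTopology A τ n a) (hl₁ : 0 ≤ l₁) (hK : ∀ t, 0 ≤ t → ‖y t‖ ≤ K) (i : Fin N) :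
    Tendsto (fun t => field b ρ l₁ l₂ (a t) (y t) .energy i) atTop (𝓝 0) := by
  obtain ⟨L, hL⟩ := h.exists_lipschitzOnWith htop hK
  obtain ⟨L', hL'⟩ := htop.exists_lipschitzOnWith_comp
    (Φ := fun B z => field b ρ l₁ l₂ B z .energy i)
    (fun l => contDiff_pi.1 (contDiff_pi.1 (contDiff_field b ρ l₁ l₂ (A l)) .energy) i) hK hL
  obtain ⟨τmin, hpos, hdwell⟩ := htop.dwell
  have henergy : ∀ t, 0 ≤ t → y t .energy i ≤ K := fun t ht => (le_abs_self _).trans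
    ((norm_le_pi_norm (y t .energy) i).trans ((norm_le_pi_norm (y t) .energy).trans (hK t ht)))
  refine tendsto_zero_of_bddAbove_primitive (h.continuousOn_comp (contDiff_coord .energy i))
    (fun t ht => h.deriv_coord_Ici ht .energy i) (fun t _ => field_energy_nonneg hl₁ _ _ i)
    henergy fun ε hε => ?_
  simpa only [htop.start] using
    exists_window_of_lipschitzOnWith_Ico hpos (fun j => (hdwell j).le) hL' hε

theorem tendsto_q_mul_r (h : IsTrajectory b ρ l₁ l₂ a (fun _ => 1) (Ici 0) y)
    (htop : SwitchingTopology A τ n a) (hl₁ : 0 < l₁) (hK : ∀ t, 0 ≤ t → ‖y t‖ ≤ K) (i : Fin N) :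
    Tendsto (fun t => q ρ (y t) i * r ρ (a t) (y t) i) atTop (𝓝 0) := by
  refine tendsto_zero_of_mul_sq_le hl₁ (fun t => ?_) (h.tendsto_field_energy htop hl₁.le hK i)
  rw [mul_pow]
  exact le_add_of_nonneg_right (sq_nonneg _)

theorem tendsto_vel (h : IsTrajectory b ρ l₁ l₂ a (fun _ => 1) (Ici 0) y)
    (htop : SwitchingTopology A τ n a) (hl₁ : 0 ≤ l₁) (hK : ∀ t, 0 ≤ t → ‖y t‖ ≤ K) (i : Fin N) :
    Tendsto (fun t => y t .vel i) atTop (𝓝 0) := by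
  refine tendsto_zero_of_mul_sq_le one_pos (fun t => ?_) (h.tendsto_field_energy htop hl₁ hK i)
  rw [one_mul]
  exact le_add_of_nonneg_left (by positivity)

theorem tendsto_pos_sub_of_isBasisBicomponent
    (h : IsTrajectory b ρ l₁ l₂ a (fun _ => 1) (Ici 0) y) (htop : SwitchingTopology A τ n a)
    (hρ : ρ ≠ 0) (hl₁ : 0 < l₁) (hK : ∀ t, 0 ≤ t → ‖y t‖ ≤ K) {l : Fin M} {S : Set (Fin N)}
    (hS : IsBasisBicomponent (graphOf (A l)) S) {i k : Fin N} (hi : i ∈ S) (hk : k ∈ S) :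
    Tendsto (fun t => y t .pos i - y t .pos k) atTop (𝓝 0) := by
  obtain ⟨s, D, hs⟩ := htop.exists_active l
  have hs_top : Tendsto s atTop atTop :=
    tendsto_atTop_mono' _ (hs.mono fun t ht => ht.1.1) tendsto_id
  obtain ⟨C, hC⟩ := htop.exists_forall_norm_le_comp (Φ := fun _ => q ρ)
    (fun _ => continuous_pi fun i => (contDiff_q ρ i).continuous) hK
  have hlap : ∀ j, Tendsto
      (fun t => q ρ (y (s t)) j * (laplacian (A l)).mulVec (q ρ (y (s t))) j) atTop (𝓝 0) :=
    fun j => ((h.tendsto_q_mul_r htop hl₁ hK j).comp hs_top).congr' <| hs.mono fun t ht => by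
      rw [Function.comp_apply, r_eq_laplacian_mulVec, ht.2]
  have hq : Tendsto (fun t => q ρ (y (s t)) i - q ρ (y (s t)) k) atTop (𝓝 0) :=
    hS.tendsto_sub (htop.weights_nonneg l)
      ((hs_top.eventually_ge_atTop 0).mono fun t ht => hC (s t) ht) hlap hi hk
  have hv : ∀ j, Tendsto (fun t => y (s t) .vel j) atTop (𝓝 0) := fun j =>
    (h.tendsto_vel htop hl₁.le hK j).comp hs_top
  have hx : ∀ j, Tendsto (fun t => y (s t) .pos j - y t .pos j) atTop (𝓝 0) := fun j =>
    tendsto_sub_of_tendsto_deriv_zero (h.continuousOn_comp (contDiff_coord .pos j))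
      (fun t ht => h.deriv_coord_Ici ht .pos j) (h.tendsto_vel htop hl₁.le hK j)
      (hs.mono fun t ht => ht.1)
  have hsum := (((hq.sub (hv i)).add (hv k)).div_const ρ).sub ((hx i).sub (hx k))
  simp only [sub_zero, add_zero, zero_div] at hsum
  refine hsum.congr fun t => ?_
  simp only [q]
  field_simp
  ring

theorem tendsto_pos_sub (h : IsTrajectory b ρ l₁ l₂ a (fun _ => 1) (Ici 0) y)
    (htop : SwitchingTopology A τ n a) (hρ : ρ ≠ 0) (hl₁ : 0 < l₁)
    (hK : ∀ t, 0 ≤ t → ‖y t‖ ≤ K) (i k : Fin N) :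
    Tendsto (fun t => y t .pos i - y t .pos k) atTop (𝓝 0) :=
  htop.joint.tendsto_sub (x := fun i t => y t .pos i) (fun _ _ hS _ hi _ hk =>
    h.tendsto_pos_sub_of_isBasisBicomponent htop hρ hl₁ hK hS hi hk) i k

end State.IsTrajectory

/-! ### Closed-loop solutions -/

noncomputable section

variable {N M : ℕ} {A : Fin M → Matrix (Fin N) (Fin N) ℝ} {τ : ℕ → ℝ} {n : ℕ → Fin M}
  {a : ℝ → Matrix (Fin N) (Fin N) ℝ} {b : Fin N → ℝ} {ρ l₁ l₂ T : ℝ} {x v : Fin N → ℝ → ℝ}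

/-- The augmented state at time `t` of agents with positions `x` and velocities `v`. -/
def stateOf (ρ l₁ : ℝ) (a : ℝ → Matrix (Fin N) (Fin N) ℝ) (x v : Fin N → ℝ → ℝ) (t : ℝ) : State N
  | .pos, i => x i t
  | .vel, i => v i t
  | .corr, i => ∫ s in (0 : ℝ)..t, q ρ x v i s * r ρ a x v i s
  | .energy, i => l₁ * (∫ s in (0 : ℝ)..t, q ρ x v i s ^ 2 * r ρ a x v i s ^ 2)
      + ∫ s in (0 : ℝ)..t, v i s ^ 2

theorem R_stateOf (i : Fin N) (t : ℝ) :
    State.R ρ l₂ (stateOf ρ l₁ a x v t) i = R ρ l₁ l₂ a x v i t := by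
  simp only [State.R, State.q, stateOf, R, q]
  ring

theorem u_stateOf (i : Fin N) (t : ℝ) :
    State.u ρ l₁ l₂ (a t) (stateOf ρ l₁ a x v t) i = u ρ l₁ l₂ a x v i t := by
  rw [State.u, R_stateOf]
  rfl

theorem stateOf_congr_zero {x' v' : Fin N → ℝ → ℝ} (h : ∀ i, x i 0 = x' i 0 ∧ v i 0 = v' i 0) :
    stateOf ρ l₁ a x v 0 = stateOf ρ l₁ a x' v' 0 := by
  funext m i
  cases m <;> simp [stateOf, h i]

theorem stateOf_zero_corr : stateOf ρ l₁ a x v 0 .corr = 0 := by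
  funext i
  simp [stateOf]

theorem stateOf_zero_energy : stateOf ρ l₁ a x v 0 .energy = 0 := by
  funext i
  simp [stateOf]

theorem continuousOn_q {J : Set ℝ} {i : Fin N} (hx : ContinuousOn (x i) J)
    (hv : ContinuousOn (v i) J) : ContinuousOn (q ρ x v i) J := by
  unfold q; fun_prop

theorem continuousOn_r {J : Set ℝ} (hx : ∀ i, ContinuousOn (x i) J)
    (hv : ∀ i, ContinuousOn (v i) J) (B : Matrix (Fin N) (Fin N) ℝ) (i : Fin N) :
    ContinuousOn (r ρ (fun _ => B) x v i) J := by
  unfold r disagreement; fun_prop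

theorem continuousOn_stateOf (htop : SwitchingTopology A τ n a)
    (hx : ∀ i, ContinuousOn (x i) (Ico 0 T)) (hv : ∀ i, ContinuousOn (v i) (Ico 0 T)) :
    ContinuousOn (stateOf ρ l₁ a x v) (Ico 0 T) := by
  have hq := fun i => continuousOn_q (ρ := ρ) (hx i) (hv i)
  have hr := fun (l : Fin M) => continuousOn_r (ρ := ρ) hx hv (A l)
  refine continuousOn_pi.2 fun m => continuousOn_pi.2 fun i => ?_
  cases m with
  | pos => exact hx i
  | vel => exact hv i
  | corr =>
    exact htop.continuousOn_integral
      (G := fun B s => q ρ x v i s * r ρ (fun _ => B) x v i s) fun l => (hq i).mul (hr l i)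
  | energy =>
    exact ((htop.continuousOn_integral
        (G := fun B s => q ρ x v i s ^ 2 * r ρ (fun _ => B) x v i s ^ 2)
        fun l => ((hq i).pow 2).mul ((hr l i).pow 2)).const_smul l₁).add
      (htop.continuousOn_integral (G := fun _ s => v i s ^ 2) fun _ => (hv i).pow 2)

theorem hasDerivWithinAt_stateOf_corr (htop : SwitchingTopology A τ n a)
    (hx : ∀ i, ContinuousOn (x i) (Ico 0 T)) (hv : ∀ i, ContinuousOn (v i) (Ico 0 T)) {t : ℝ}
    (ht : t ∈ Ico 0 T) (i : Fin N) :
    HasDerivWithinAt (fun t => stateOf ρ l₁ a x v t .corr i)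
      (State.field b ρ l₁ l₂ (a t) (stateOf ρ l₁ a x v t) .corr i) (Ici t) t :=
  htop.hasDerivWithinAt_integral (G := fun B s => q ρ x v i s * r ρ (fun _ => B) x v i s)
    (fun l => (continuousOn_q (hx i) (hv i)).mul (continuousOn_r hx hv (A l) i)) ht

theorem hasDerivWithinAt_stateOf_energy (htop : SwitchingTopology A τ n a)
    (hx : ∀ i, ContinuousOn (x i) (Ico 0 T)) (hv : ∀ i, ContinuousOn (v i) (Ico 0 T)) {t : ℝ}
    (ht : t ∈ Ico 0 T) (i : Fin N) :
    HasDerivWithinAt (fun t => stateOf ρ l₁ a x v t .energy i)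
      (State.field b ρ l₁ l₂ (a t) (stateOf ρ l₁ a x v t) .energy i) (Ici t) t :=
  ((htop.hasDerivWithinAt_integral
      (G := fun B s => q ρ x v i s ^ 2 * r ρ (fun _ => B) x v i s ^ 2)
      (fun l => ((continuousOn_q (hx i) (hv i)).pow 2).mul
        ((continuousOn_r hx hv (A l) i).pow 2)) ht).const_mul l₁).add
    (htop.hasDerivWithinAt_integral (G := fun _ s => v i s ^ 2) (fun _ => (hv i).pow 2) ht)

namespace IsClosedLoopSolution

theorem mono {J J' : Set ℝ} (h : IsClosedLoopSolution b ρ l₁ l₂ τ a J x v) (hJ : J' ⊆ J) :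
    IsClosedLoopSolution b ρ l₁ l₂ τ a J' x v :=
  ⟨fun i => (h.cont_x i).mono hJ, fun i => (h.cont_v i).mono hJ,
    fun i t ht => h.deriv_x i t (hJ ht), fun i t ht => h.deriv_v i t (hJ ht)⟩

theorem isTrajectory (h : IsClosedLoopSolution b ρ l₁ l₂ τ a (Ico 0 T) x v)
    (htop : SwitchingTopology A τ n a) :
    State.IsTrajectory b ρ l₁ l₂ a (fun _ => 1) (Ico 0 T) (stateOf ρ l₁ a x v) := by
  have hcont := continuousOn_stateOf (ρ := ρ) (l₁ := l₁) htop h.cont_x h.cont_v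
  refine ⟨hcont, fun t ht => ?_⟩
  rw [one_smul]
  refine hasDerivWithinAt_pi.2 fun m => hasDerivWithinAt_pi.2 fun i => ?_
  cases m with
  | pos =>
    exact htop.hasDerivWithinAt_Ici (h.cont_x i) (h.deriv_x i) ht
      (htop.continuousWithinAt_Ici (G := fun _ => v i) (fun _ => h.cont_v i) ht)
  | vel =>
    refine htop.hasDerivWithinAt_Ici
      (f := fun s => b i * State.u ρ l₁ l₂ (a s) (stateOf ρ l₁ a x v s) i) (h.cont_v i)
      (fun s hs hsτ => ?_) ht ?_
    · rw [u_stateOf]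
      exact h.deriv_v i s hs hsτ
    · exact htop.continuousWithinAt_Ici
        (G := fun B s => b i * State.u ρ l₁ l₂ B (stateOf ρ l₁ a x v s) i) (fun l =>
        ((State.contDiff_u ρ l₁ l₂ (A l) i).continuous.comp_continuousOn hcont).const_smul (b i))
        ht
  | corr => exact hasDerivWithinAt_stateOf_corr htop h.cont_x h.cont_v ht i
  | energy => exact hasDerivWithinAt_stateOf_energy htop h.cont_x h.cont_v ht i

theorem isTrajectory_Ici (h : IsClosedLoopSolution b ρ l₁ l₂ τ a (Ici 0) x v)
    (htop : SwitchingTopology A τ n a) :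
    State.IsTrajectory b ρ l₁ l₂ a (fun _ => 1) (Ici 0) (stateOf ρ l₁ a x v) := by
  have htraj := fun T => (h.mono (J' := Ico 0 T) Ico_subset_Ici_self).isTrajectory htop
  exact ⟨continuousOn_Ici_of_forall_Ico fun T => (htraj T).continuousOn,
    fun t ht => (htraj (t + 1)).deriv t ⟨ht, lt_add_one t⟩⟩

theorem unique {x' v' : Fin N → ℝ → ℝ} (htop : SwitchingTopology A τ n a)
    (h : IsClosedLoopSolution b ρ l₁ l₂ τ a (Ico 0 T) x v)
    (h' : IsClosedLoopSolution b ρ l₁ l₂ τ a (Ico 0 T) x' v')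
    (h0 : ∀ i, x i 0 = x' i 0 ∧ v i 0 = v' i 0) (i : Fin N) {t : ℝ} (ht : t ∈ Ico 0 T) :
    x i t = x' i t ∧ v i t = v' i t := by
  have hstate : stateOf ρ l₁ a x v t = stateOf ρ l₁ a x' v' t :=
    (h.isTrajectory htop).eqOn (fun s hs => htop.exists_eq hs) (h'.isTrajectory htop)
      (stateOf_congr_zero h0) ht
  exact ⟨congrFun (congrFun hstate .pos) i, congrFun (congrFun hstate .vel) i⟩

theorem exists_bound_stateOf (h : IsClosedLoopSolution b ρ l₁ l₂ τ a (Ici 0) x v)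
    (htop : SwitchingTopology A τ n a) (hb : ∀ i, b i ≠ 0) (hρ : 0 < ρ) (hl₁ : 0 ≤ l₁)
    (hl₂ : 0 < l₂) : ∃ K, ∀ t, 0 ≤ t → ‖stateOf ρ l₁ a x v t‖ ≤ K := by
  obtain ⟨K, hK⟩ := State.IsTrajectory.exists_bound hb hρ hl₁ hl₂ (fun t ht => htop.exists_eq ht)
    (stateOf ρ l₁ a x v 0) stateOf_zero_energy.ge
  exact ⟨K, fun t ht => hK _ (t + 1) _ (fun _ => right_mem_Icc.2 zero_le_one)
    ((h.isTrajectory_Ici htop).mono Ico_subset_Ici_self) rfl t ⟨ht, lt_add_one t⟩⟩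

end IsClosedLoopSolution

theorem exists_bound_of_stateOf (htop : SwitchingTopology A τ n a) {K : ℝ}
    (hK : ∀ t, 0 ≤ t → ‖stateOf ρ l₁ a x v t‖ ≤ K) (i : Fin N) :
    ∃ C : ℝ, ∀ t, 0 ≤ t → |x i t| ≤ C ∧ |v i t| ≤ C ∧ |u ρ l₁ l₂ a x v i t| ≤ C := by
  obtain ⟨C, hC⟩ := htop.exists_forall_norm_le_comp (Φ := fun B y => State.u ρ l₁ l₂ B y i)
    (fun l => (State.contDiff_u ρ l₁ l₂ (A l) i).continuous) hK
  have hcoord : ∀ t, 0 ≤ t → ∀ m, |stateOf ρ l₁ a x v t m i| ≤ K := fun t ht m =>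
    ((norm_le_pi_norm _ i).trans (norm_le_pi_norm (stateOf ρ l₁ a x v t) m)).trans (hK t ht)
  refine ⟨max K C, fun t ht => ⟨(hcoord t ht .pos).trans (le_max_left _ _),
    (hcoord t ht .vel).trans (le_max_left _ _), ?_⟩⟩
  rw [← u_stateOf]
  exact (hC t ht).trans (le_max_right _ _)

/-! ### Existence of closed-loop solutions -/

theorem exists_isTrajectory_of_hasCompactSupport (htop : SwitchingTopology A τ n a)
    {χ : State N → ℝ} (hχ : ContDiff ℝ 1 χ) (hχ' : HasCompactSupport χ) (y₀ : State N) :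
    ∃ y, y 0 = y₀ ∧ State.IsTrajectory b ρ l₁ l₂ a (fun t => χ (y t)) (Ici 0) y ∧
      ∀ t, 0 ≤ t → t ∉ range τ →
        HasDerivAt y (χ (y t) • State.field b ρ l₁ l₂ (a t) (y t)) t := by
  have hsmooth : ∀ l, ContDiff ℝ 1 fun z => χ z • State.field b ρ l₁ l₂ (A l) z := fun l =>
    hχ.smul (State.contDiff_field b ρ l₁ l₂ (A l))
  have hpiece : ∀ j z, ∃ α : ℝ → State N, α (τ j) = z ∧ ∀ t ∈ Icc (τ j) (τ (j + 1)),
      HasDerivWithinAt α (χ (α t) • State.field b ρ l₁ l₂ (A (n j)) (α t))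
        (Icc (τ j) (τ (j + 1))) t := fun j z => by
    obtain ⟨K, hK⟩ :=
      (hsmooth (n j)).lipschitzWith_of_hasCompactSupport hχ'.smul_right one_ne_zero
    obtain ⟨L, hL⟩ := hχ'.smul_right.exists_bound_of_continuous (hsmooth (n j)).continuous
    exact exists_forall_mem_Icc_hasDerivWithinAt_of_lipschitzWith hK
      (fun w => (hL w).trans L.le_coe_toNNReal) (htop.strictMono j.lt_succ_self).le z
  obtain ⟨y, hy₀, hy⟩ := exists_concatenation htop.strictMono
    (f := fun j z => χ z • State.field b ρ l₁ l₂ (A (n j)) z) hpiece y₀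
  rw [htop.start] at hy₀
  refine ⟨y, hy₀, ⟨?_, fun t ht => ?_⟩, fun t ht htτ => ?_⟩
  · rw [← htop.start]
    exact continuousOn_Ici_of_forall_Icc_succ htop.strictMono.monotone htop.tendsto_atTop
      fun j t ht => (hy j t ht).continuousWithinAt
  · obtain ⟨j, hj⟩ := htop.exists_mem_Ico ht
    rw [htop.active j t hj]
    exact (hy j t (Ico_subset_Icc_self hj)).mono_of_mem_nhdsWithin
      (mem_of_superset (Icc_mem_nhdsGE hj.2) (Icc_subset_Icc_left hj.1))
  · obtain ⟨j, hj⟩ := htop.exists_mem_Ioo ht htτ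
    rw [htop.active j t (Ioo_subset_Ico_self hj)]
    exact (hy j t (Ioo_subset_Icc_self hj)).hasDerivAt (Icc_mem_nhds hj.1 hj.2)

theorem stateOf_eq_of_isTrajectory (htop : SwitchingTopology A τ n a) {y : ℝ → State N}
    (h : State.IsTrajectory b ρ l₁ l₂ a (fun _ => 1) (Ici 0) y) (hcorr : y 0 .corr = 0)
    (henergy : y 0 .energy = 0) {t : ℝ} (ht : 0 ≤ t) :
    stateOf ρ l₁ a (fun i t => y t .pos i) (fun i t => y t .vel i) t = y t := by
  have hsub : Icc 0 t ⊆ Ico 0 (t + 1) := Icc_subset_Ico_right (lt_add_one t)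
  have hcoord : ∀ m i, ContinuousOn (fun t => y t m i) (Ici 0) := fun m i =>
    h.continuousOn_comp (State.contDiff_coord m i)
  have hcoord' : ∀ m i, ContinuousOn (fun t => y t m i) (Ico 0 (t + 1)) := fun m i =>
    (hcoord m i).mono Ico_subset_Ici_self
  have hcont : ∀ m i, ContinuousOn
      (fun t => stateOf ρ l₁ a (fun i t => y t .pos i) (fun i t => y t .vel i) t m i) (Icc 0 t) :=
    fun m i => (State.contDiff_coord m i).continuous.comp_continuousOn
      ((continuousOn_stateOf htop (hcoord' .pos) (hcoord' .vel)).mono hsub)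
  funext m i
  cases m with
  | pos => rfl
  | vel => rfl
  | corr =>
    exact eq_of_has_deriv_right_eq
      (fun s hs => hasDerivWithinAt_stateOf_corr (b := b) (l₂ := l₂) htop
        (hcoord' .pos) (hcoord' .vel) (hsub (Ico_subset_Icc_self hs)) i)
      (fun s hs => h.deriv_coord_Ici hs.1 .corr i) (hcont .corr i)
      ((hcoord .corr i).mono Icc_subset_Ici_self)
      (congrFun (stateOf_zero_corr.trans hcorr.symm) i) t ⟨ht, le_rfl⟩
  | energy =>
    exact eq_of_has_deriv_right_eq
      (fun s hs => hasDerivWithinAt_stateOf_energy (b := b) (l₂ := l₂) htop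
        (hcoord' .pos) (hcoord' .vel) (hsub (Ico_subset_Icc_self hs)) i)
      (fun s hs => h.deriv_coord_Ici hs.1 .energy i) (hcont .energy i)
      ((hcoord .energy i).mono Icc_subset_Ici_self)
      (congrFun (stateOf_zero_energy.trans henergy.symm) i) t ⟨ht, le_rfl⟩

theorem isClosedLoopSolution_of_isTrajectory (htop : SwitchingTopology A τ n a)
    {y : ℝ → State N} (h : State.IsTrajectory b ρ l₁ l₂ a (fun _ => 1) (Ici 0) y)
    (hd : ∀ t, 0 ≤ t → t ∉ range τ → HasDerivAt y (State.field b ρ l₁ l₂ (a t) (y t)) t)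
    (hcorr : y 0 .corr = 0) (henergy : y 0 .energy = 0) :
    IsClosedLoopSolution b ρ l₁ l₂ τ a (Ici 0) (fun i t => y t .pos i) (fun i t => y t .vel i) where
  cont_x i := h.continuousOn_comp (State.contDiff_coord .pos i)
  cont_v i := h.continuousOn_comp (State.contDiff_coord .vel i)
  deriv_x i t ht htτ := hasDerivAt_pi.1 (hasDerivAt_pi.1 (hd t ht htτ) .pos) i
  deriv_v i t ht htτ := by
    rw [← u_stateOf, stateOf_eq_of_isTrajectory htop h hcorr henergy ht]
    exact hasDerivAt_pi.1 (hasDerivAt_pi.1 (hd t ht htτ) .vel) i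

theorem exists_isClosedLoopSolution (htop : SwitchingTopology A τ n a) (hb : ∀ i, b i ≠ 0)
    (hρ : 0 < ρ) (hl₁ : 0 ≤ l₁) (hl₂ : 0 < l₂) (x₀ v₀ : Fin N → ℝ) :
    ∃ x v : Fin N → ℝ → ℝ, IsClosedLoopSolution b ρ l₁ l₂ τ a (Ici 0) x v ∧
      ∀ i, x i 0 = x₀ i ∧ v i 0 = v₀ i := by
  let y₀ : State N := stateOf ρ l₁ a (fun i _ => x₀ i) (fun i _ => v₀ i) 0
  obtain ⟨K, hK⟩ := State.IsTrajectory.exists_bound hb hρ hl₁ hl₂ (fun t ht => htop.exists_eq ht)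
    y₀ stateOf_zero_energy.ge
  let χ : ContDiffBump (0 : State N) := ⟨|K| + 1, |K| + 2, by positivity, by linarith⟩
  obtain ⟨y, hy₀, hy, hd⟩ := exists_isTrajectory_of_hasCompactSupport (b := b) (ρ := ρ) (l₁ := l₁)
    (l₂ := l₂) htop χ.contDiff χ.hasCompactSupport y₀
  have hχ : ∀ t, 0 ≤ t → χ (y t) = 1 := fun t ht => by
    have hyt : ‖y t‖ ≤ K := hK _ (t + 1) y (fun _ => ⟨χ.nonneg, χ.le_one⟩)
      (hy.mono Ico_subset_Ici_self) hy₀ t ⟨ht, lt_add_one t⟩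
    exact χ.one_of_mem_closedBall
      (mem_closedBall_zero_iff.2 (hyt.trans ((le_abs_self K).trans (by simp [χ]))))
  have htraj : State.IsTrajectory b ρ l₁ l₂ a (fun _ => 1) (Ici 0) y :=
    ⟨hy.continuousOn, fun t ht => by simpa only [hχ t ht] using hy.deriv t ht⟩
  refine ⟨_, _, isClosedLoopSolution_of_isTrajectory htop htraj
    (fun t ht htτ => by simpa only [hχ t ht, one_smul] using hd t ht htτ)
    ((congrFun hy₀ .corr).trans stateOf_zero_corr)
    ((congrFun hy₀ .energy).trans stateOf_zero_energy), fun i => ?_⟩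
  rw [hy₀]
  exact ⟨rfl, rfl⟩

end

end ConsensusPI

theorem theorem2 {N M : ℕ} (b : Fin N → ℝ) (hb : ∀ i, b i ≠ 0)
    (A : Fin M → Matrix (Fin N) (Fin N) ℝ) (τ : ℕ → ℝ) (n : ℕ → Fin M)
    (a : ℝ → Matrix (Fin N) (Fin N) ℝ)
    (htop : ConsensusPI.SwitchingTopology A τ n a)
    (ρ l₁ l₂ : ℝ) (hρ : 0 < ρ) (hl₁ : 0 < l₁) (hl₂ : 0 < l₂) :
    -- for all initial data the closed loop has a solution on `[0, ∞)`
    (∀ x₀ v₀ : Fin N → ℝ, ∃ x v : Fin N → ℝ → ℝ,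
      ConsensusPI.IsClosedLoopSolution b ρ l₁ l₂ τ a (Ici 0) x v ∧
      ∀ i, x i 0 = x₀ i ∧ v i 0 = v₀ i) ∧
    -- solutions are unique on every interval `[0, T)`
    (∀ T : ℝ, 0 < T → ∀ x v x' v' : Fin N → ℝ → ℝ,
      ConsensusPI.IsClosedLoopSolution b ρ l₁ l₂ τ a (Ico 0 T) x v →
      ConsensusPI.IsClosedLoopSolution b ρ l₁ l₂ τ a (Ico 0 T) x' v' →
      (∀ i, x i 0 = x' i 0 ∧ v i 0 = v' i 0) →
      ∀ i, ∀ t ∈ Ico 0 T, x i t = x' i t ∧ v i t = v' i t) ∧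
    -- every solution is bounded and reaches consensus
    (∀ x v : Fin N → ℝ → ℝ,
      ConsensusPI.IsClosedLoopSolution b ρ l₁ l₂ τ a (Ici 0) x v →
      (∀ i, ∃ C : ℝ, ∀ t : ℝ, 0 ≤ t →
        |x i t| ≤ C ∧ |v i t| ≤ C ∧ |ConsensusPI.u ρ l₁ l₂ a x v i t| ≤ C) ∧
      (∀ i k, Tendsto (fun t => x i t - x k t) atTop (𝓝 0)) ∧
      (∀ i k, Tendsto (fun t => v i t - v k t) atTop (𝓝 0)) ∧
      ∀ i, Tendsto (v i) atTop (𝓝 0)) := by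
  refine ⟨ConsensusPI.exists_isClosedLoopSolution htop hb hρ hl₁.le hl₂,
    fun T _ x v x' v' h h' h0 i t ht => h.unique htop h' h0 i ht, fun x v h => ?_⟩
  obtain ⟨K, hK⟩ := h.exists_bound_stateOf htop hb hρ hl₁.le hl₂
  have htraj := h.isTrajectory_Ici htop
  have hv : ∀ i, Tendsto (v i) atTop (𝓝 0) := htraj.tendsto_vel htop hl₁.le hK
  exact ⟨ConsensusPI.exists_bound_of_stateOf htop hK, htraj.tendsto_pos_sub htop hρ.ne' hl₁ hK,
    fun i k => by simpa using (hv i).sub (hv k), hv⟩
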